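/- Let $\mathfrak g$ be a finite-dimensional semisimple (in particular, possibly simple) complex Lie algebra, $\mathfrak h\subset\mathfrak g$ a Cartan subalgebra, and fix a base of the root system of $(\mathfrak g,\mathfrak h)$. Let $\mathfrak n_+$ be the sum of the root spaces of the positive roots and $\mathfrak b=\mathfrak h\oplus\mathfrak n_+$. For $\lambda\in\mathfrak h^*$ let $\mathbb C_\lambda$ be the one-dimensional $\mathfrak b$-module on which $\mathfrak h$ acts by $\lambda$ and $\mathfrak n_+$ by $0$, let $M_\lambda=U(\mathfrak g)\otimes_{\mathfrak b}\mathbb C_\lambda$ be the Verma module of highest weight $\lambda$, and let $x_\lambda=1\otimes 1\in M_\lambda$. For a $\mathfrak g$-module $V$ and $\nu\in\mathfrak h^*$ write $V[\nu]=\{v\in V: h v=\nu(h)v\ \text{for all } h\in\mathfrak h\}$. Let $\lambda,\mu\in\mathfrak h^*$ be such that $M_\mu$ is irreducible, and let $V$ be a finite-dimensional $\mathfrak g$-module. Then there is a unique vector $x_\mu^*$ of weight $-\mu$ in the dual $\mathfrak g$-module $M_\mu^*$ with $\langle x_\mu,x_\mu^*\rangle=1$. Moreover, for every $\Phi\in\mathrm{Hom}_{\mathfrak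 g}(M_\lambda,M_\mu\otimes V)$ the vector $$\langle\Phi\rangle:=\langle\Phi(x_\lambda),x_\mu^*\rangle\in V$$ (where $\langle m\otimes v,x_\mu^*\rangle=\langle m,x_\mu^*\rangle v$) lies in $V[\lambda-\mu]$, and $\Phi\mapsto\langle\Phi\rangle$ is a linear isomorphism $$\mathrm{Hom}_{\mathfrak g}(M_\lambda,M_\mu\otimes V)\;\cong\;V[\lambda-\mu].$$ -/

import Mathlib

open scoped TensorProduct

noncomputable section

/-! ### Induced modules -/

section Induced

variable (R : Type*) {L : Type*} [CommRing R] [LieRing L] [LieAlgebra R L]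
  (𝔨 : LieSubalgebra R L)
  (W : Type*) [AddCommGroup W] [Module R W] [LieRingModule 𝔨 W] [LieModule R 𝔨 W]

/-- The `U(L)`-submodule of `U(L) ⊗[R] W` generated by the elements
`(u x) ⊗ w - u ⊗ (x · w)` with `u ∈ U(L)`, `x ∈ 𝔨`, `w ∈ W`. -/
def indRel : Submodule (UniversalEnvelopingAlgebra R L) (UniversalEnvelopingAlgebra R L ⊗[R] W) :=
  Submodule.span _ {t | ∃ (u : UniversalEnvelopingAlgebra R L) (x : 𝔨) (w : W),
    t = (u * UniversalEnvelopingAlgebra.ι R (x : L)) ⊗ₜ[R] w - u ⊗ₜ[R] ⁅x, w⁆}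

/-- The induced module `Ind_𝔨^L W = U(L) ⊗_𝔨 W`, i.e. the tensor product of the right
`U(𝔨)`-module `U(L)` with the left `U(𝔨)`-module `W`, realised as the quotient of `U(L) ⊗[R] W`
by the balancing relations. -/
def Ind : Type _ := (UniversalEnvelopingAlgebra R L ⊗[R] W) ⧸ indRel R 𝔨 W

instance Ind.instAddCommGroup : AddCommGroup (Ind R 𝔨 W) :=
  inferInstanceAs (AddCommGroup ((UniversalEnvelopingAlgebra R L ⊗[R] W) ⧸ indRel R 𝔨 W))

/-- `U(L)` acts on `Ind_𝔨^L W` by left multiplication on the first factor. -/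
instance Ind.instModuleEnveloping : Module (UniversalEnvelopingAlgebra R L) (Ind R 𝔨 W) :=
  inferInstanceAs (Module (UniversalEnvelopingAlgebra R L)
    ((UniversalEnvelopingAlgebra R L ⊗[R] W) ⧸ indRel R 𝔨 W))

instance Ind.instModule : Module R (Ind R 𝔨 W) :=
  inferInstanceAs (Module R ((UniversalEnvelopingAlgebra R L ⊗[R] W) ⧸ indRel R 𝔨 W))

instance Ind.instIsScalarTower :
    IsScalarTower R (UniversalEnvelopingAlgebra R L) (Ind R 𝔨 W) :=
  inferInstanceAs (IsScalarTower R (UniversalEnvelopingAlgebra R L)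
    ((UniversalEnvelopingAlgebra R L ⊗[R] W) ⧸ indRel R 𝔨 W))

instance Ind.instSMulCommClass :
    SMulCommClass R (UniversalEnvelopingAlgebra R L) (Ind R 𝔨 W) :=
  inferInstanceAs (SMulCommClass R (UniversalEnvelopingAlgebra R L)
    ((UniversalEnvelopingAlgebra R L ⊗[R] W) ⧸ indRel R 𝔨 W))

variable {W} in
/-- The element `u ⊗_𝔨 w` of `Ind_𝔨^L W`. -/
def Ind.tmul (u : UniversalEnvelopingAlgebra R L) (w : W) : Ind R 𝔨 W :=
  (indRel R 𝔨 W).mkQ (u ⊗ₜ[R] w)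

/-- The action of `L` on `Ind_𝔨^L W`: `a · (u ⊗_𝔨 w) = (a u) ⊗_𝔨 w`. -/
instance Ind.instLieRingModule : LieRingModule L (Ind R 𝔨 W) where
  bracket a m := UniversalEnvelopingAlgebra.ι R a • m
  add_lie a b m := by
    change UniversalEnvelopingAlgebra.ι R (a + b) • m = _
    rw [map_add, add_smul]
  lie_add a m n := smul_add _ m n
  leibniz_lie a b m := by
    change UniversalEnvelopingAlgebra.ι R a • UniversalEnvelopingAlgebra.ι R b • m =
      UniversalEnvelopingAlgebra.ι R ⁅a, b⁆ • m +
        UniversalEnvelopingAlgebra.ι R b • UniversalEnvelopingAlgebra.ι R a • m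
    let := LieRing.ofAssociativeRing (A := UniversalEnvelopingAlgebra R L)
    rw [LieHom.map_lie, LieRing.of_associative_ring_bracket, smul_smul, smul_smul, ← add_smul,
      sub_add_cancel]

theorem Ind.lie_def (a : L) (m : Ind R 𝔨 W) : ⁅a, m⁆ = UniversalEnvelopingAlgebra.ι R a • m := rfl

variable {W} in
theorem Ind.lie_tmul (a : L) (u : UniversalEnvelopingAlgebra R L) (w : W) :
    ⁅a, Ind.tmul R 𝔨 u w⁆ = Ind.tmul R 𝔨 (UniversalEnvelopingAlgebra.ι R a * u) w := by
  rw [Ind.lie_def, Ind.tmul, Ind.tmul, ← smul_eq_mul, ← TensorProduct.smul_tmul', map_smul]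
  rfl

instance Ind.instLieModule : LieModule R L (Ind R 𝔨 W) where
  smul_lie t a m := by
    rw [Ind.lie_def, Ind.lie_def, map_smul, smul_assoc]
  lie_smul t a m := by
    rw [Ind.lie_def, Ind.lie_def, smul_comm]

end Induced

/-! ### Borel subalgebras and Verma modules -/

namespace Verma

open LieAlgebra LieAlgebra.IsKilling

variable {𝔤 : Type*} [LieRing 𝔤] [LieAlgebra ℂ 𝔤] [FiniteDimensional ℂ 𝔤] [IsKilling ℂ 𝔤]
  {𝔥 : LieSubalgebra ℂ 𝔤} [𝔥.IsCartanSubalgebra]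
  (Δ : RootPairing.Base (rootSystem 𝔥))

/-- `𝔫₊`: the sum of the root spaces of the roots that are positive with respect to the base `Δ`
of the root system of `(𝔤, 𝔥)`. -/
def nPos : Submodule ℂ 𝔤 :=
  ⨆ (α : 𝔥.root) (_ : Δ.IsPos α), (rootSpace 𝔥 (α : LieModule.Weight ℂ 𝔥 𝔤)).toSubmodule

theorem rootSpace_le_nPos {α : 𝔥.root} (hα : Δ.IsPos α) {x : 𝔤}
    (hx : x ∈ rootSpace 𝔥 (α : LieModule.Weight ℂ 𝔥 𝔤)) : x ∈ nPos Δ :=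
  Submodule.mem_iSup_of_mem α (Submodule.mem_iSup_of_mem hα hx)

/-- Induction principle for elements of `𝔫₊`. -/
theorem nPos_induction {p : 𝔤 → Prop}
    (mem : ∀ (α : 𝔥.root), Δ.IsPos α →
      ∀ x ∈ rootSpace 𝔥 (α : LieModule.Weight ℂ 𝔥 𝔤), p x)
    (zero : p 0) (add : ∀ x y, p x → p y → p (x + y)) {x : 𝔤} (hx : x ∈ nPos Δ) : p x := by
  refine Submodule.iSup_induction _ (motive := p) hx (fun α y hy => ?_) zero add
  exact Submodule.iSup_induction _ (motive := p) hy (fun hα z hz => mem α hα z hz) zero add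

theorem lie_cartan_nPos {h x : 𝔤} (hh : h ∈ 𝔥) (hx : x ∈ nPos Δ) : ⁅h, x⁆ ∈ nPos Δ := by
  refine nPos_induction Δ (p := fun x => ⁅h, x⁆ ∈ nPos Δ) (fun α hα y hy => ?_) (by simp)
    (fun a b ha hb => by rw [lie_add]; exact add_mem ha hb) hx
  exact rootSpace_le_nPos Δ hα
    ((rootSpace 𝔥 (α : LieModule.Weight ℂ 𝔥 𝔤)).lie_mem (x := ⟨h, hh⟩) hy)

theorem lie_nPos_nPos {x y : 𝔤} (hx : x ∈ nPos Δ) (hy : y ∈ nPos Δ) : ⁅x, y⁆ ∈ nPos Δ := by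
  refine nPos_induction Δ (p := fun x => ⁅x, y⁆ ∈ nPos Δ) (fun α hα a ha => ?_) (by simp)
    (fun a b ha hb => by rw [add_lie]; exact add_mem ha hb) hx
  refine nPos_induction Δ (p := fun y => ⁅a, y⁆ ∈ nPos Δ) (fun β hβ b hb => ?_) (by simp)
    (fun a b ha hb => by rw [lie_add]; exact add_mem ha hb) hy
  have hab := lie_mem_genWeightSpace_of_mem_genWeightSpace ha hb
  by_cases h0 : ⁅a, b⁆ = 0
  · rw [h0]; exact zero_mem _
  have hne : rootSpace 𝔥 ((α : LieModule.Weight ℂ 𝔥 𝔤) + (β : LieModule.Weight ℂ 𝔥 𝔤) : 𝔥 → ℂ)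
      ≠ ⊥ := fun h => h0 (by
        have hab' : ⁅a, b⁆ ∈ (⊥ : LieSubmodule ℂ 𝔥 𝔤) := h ▸ hab
        simpa using hab')
  let γ : LieModule.Weight ℂ 𝔥 𝔤 := ⟨_, hne⟩
  have hγ : γ.IsNonZero := by
    intro hz
    have hz' : ((α : LieModule.Weight ℂ 𝔥 𝔤) : 𝔥 → ℂ) + (β : LieModule.Weight ℂ 𝔥 𝔤) = 0 := hz
    let := (rootSystem 𝔥).indexNeg
    have hβα : β = -α := by
      apply (rootSystem 𝔥).root.injective
      rw [RootPairing.indexNeg_neg, RootPairing.root_reflectionPerm,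
        RootPairing.reflection_apply_self]
      ext t
      have := congrFun hz' t
      simp only [Pi.add_apply, Pi.zero_apply] at this
      simpa using eq_neg_of_add_eq_zero_right this
    rw [hβα] at hβ
    exact (RootPairing.Base.IsPos.neg_iff_not Δ α).1 hβ hα
  refine rootSpace_le_nPos Δ (α := ⟨γ, by simpa using hγ⟩) ?_ hab
  refine RootPairing.Base.IsPos.add hα hβ ?_
  ext t
  rfl

/-- The Borel subalgebra `𝔟 = 𝔥 ⊕ 𝔫₊`. -/
def borel : LieSubalgebra ℂ 𝔤 where
  __ := 𝔥.toSubmodule ⊔ nPos Δ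
  lie_mem' := by
    intro x y hx hy
    obtain ⟨h, hh, n, hn, rfl⟩ := Submodule.mem_sup.1 hx
    obtain ⟨h', hh', n', hn', rfl⟩ := Submodule.mem_sup.1 hy
    simp only [add_lie, lie_add]
    refine add_mem (add_mem (Submodule.mem_sup_left (𝔥.lie_mem hh hh'))
      (Submodule.mem_sup_right ?_)) (Submodule.mem_sup_right (add_mem ?_ ?_))
    · rw [← lie_skew]; exact neg_mem (lie_cartan_nPos Δ hh' hn)
    · exact lie_cartan_nPos Δ hh hn'
    · exact lie_nPos_nPos Δ hn hn'

/-- The linear form on `𝔤` that extends `lam ∈ 𝔥*` by zero on all root spaces, written as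
the pairing under the Killing form with the element of `𝔥` that represents `lam`;
see `extend_cartan` and `extend_rootSpace`. -/
def extend (lam : Module.Dual ℂ 𝔥) : 𝔤 →ₗ[ℂ] ℂ :=
  killingForm ℂ 𝔤 ((cartanEquivDual 𝔥).symm lam : 𝔤)

theorem extend_cartan (lam : Module.Dual ℂ 𝔥) (h : 𝔥) : extend lam (h : 𝔤) = lam h := by
  conv_rhs => rw [← (cartanEquivDual 𝔥).apply_symm_apply lam]
  rfl

theorem extend_rootSpace (lam : Module.Dual ℂ 𝔥) (α : 𝔥.root) {x : 𝔤}
    (hx : x ∈ rootSpace 𝔥 (α : LieModule.Weight ℂ 𝔥 𝔤)) : extend lam x = 0 := by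
  refine killingForm_apply_eq_zero_of_mem_rootSpace_of_add_ne_zero ℂ 𝔤 𝔥 (α := 0)
    (β := (α : LieModule.Weight ℂ 𝔥 𝔤)) ?_ hx ?_
  · exact le_zeroRootSubalgebra ℂ 𝔤 𝔥 ((cartanEquivDual 𝔥).symm lam).2
  · simp

theorem extend_nPos (lam : Module.Dual ℂ 𝔥) {x : 𝔤} (hx : x ∈ nPos Δ) : extend lam x = 0 :=
  nPos_induction Δ (p := fun x => extend lam x = 0) (fun α _ _ hy => extend_rootSpace lam α hy)
    (map_zero _) (fun a b ha hb => by rw [map_add, ha, hb, add_zero]) hx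

theorem extend_lie_borel (lam : Module.Dual ℂ 𝔥) {x y : 𝔤} (hx : x ∈ borel Δ)
    (hy : y ∈ borel Δ) : extend lam ⁅x, y⁆ = 0 := by
  obtain ⟨h, hh, n, hn, rfl⟩ := Submodule.mem_sup.1 hx
  obtain ⟨h', hh', n', hn', rfl⟩ := Submodule.mem_sup.1 hy
  have h0 : ⁅h, h'⁆ = 0 := by
    have := trivial_lie_zero 𝔥 𝔥 ⟨h, hh⟩ ⟨h', hh'⟩
    simpa using congrArg (Subtype.val) this
  simp only [add_lie, lie_add, map_add, h0, map_zero]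
  rw [← lie_skew n h', map_neg, extend_nPos Δ lam (lie_cartan_nPos Δ hh' hn),
    extend_nPos Δ lam (lie_cartan_nPos Δ hh hn'), extend_nPos Δ lam (lie_nPos_nPos Δ hn hn')]
  simp

/-- The one-dimensional `𝔟`-module `ℂ_lam`: the space `ℂ`, on which `𝔥` acts through `lam` and
`𝔫₊` acts by zero. -/
def OneDim (_Δ : RootPairing.Base (rootSystem 𝔥)) (_lam : Module.Dual ℂ 𝔥) : Type := ℂ

variable (lam mu : Module.Dual ℂ 𝔥)

instance : AddCommGroup (OneDim Δ lam) := inferInstanceAs (AddCommGroup ℂ)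

instance : Module ℂ (OneDim Δ lam) := inferInstanceAs (Module ℂ ℂ)

/-- The generator `1` of `ℂ_lam`. -/
def OneDim.gen : OneDim Δ lam := (1 : ℂ)

instance : LieRingModule (borel Δ) (OneDim Δ lam) where
  bracket x z := extend lam (x : 𝔤) • z
  add_lie x y z := by
    change extend lam ((x : 𝔤) + (y : 𝔤)) • z = _
    rw [map_add, add_smul]
  lie_add x z w := smul_add _ z w
  leibniz_lie x y z := by
    change extend lam (x : 𝔤) • extend lam (y : 𝔤) • z =
      extend lam ⁅(x : 𝔤), (y : 𝔤)⁆ • z + extend lam (y : 𝔤) • extend lam (x : 𝔤) • z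
    rw [extend_lie_borel Δ lam x.2 y.2, zero_smul, zero_add, smul_comm]

theorem OneDim.lie_def (x : borel Δ) (z : OneDim Δ lam) : ⁅x, z⁆ = extend lam (x : 𝔤) • z := rfl

instance : LieModule ℂ (borel Δ) (OneDim Δ lam) where
  smul_lie t x z := by
    rw [OneDim.lie_def, OneDim.lie_def]
    change extend lam (t • (x : 𝔤)) • z = _
    rw [map_smul, smul_assoc]
  lie_smul t x z := by
    rw [OneDim.lie_def, OneDim.lie_def, smul_comm]

/-- The Verma module `M_lam = U(𝔤) ⊗_𝔟 ℂ_lam` of highest weight `lam`. -/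
abbrev VermaModule : Type _ := Ind ℂ (borel Δ) (OneDim Δ lam)

/-- The highest weight vector `x_lam = 1 ⊗ 1` of `M_lam`. -/
def highestWeightVector : VermaModule Δ lam := Ind.tmul ℂ (borel Δ) 1 (OneDim.gen Δ lam)

/-- `xi` is the dual vector `x_mu^*`: the vector of weight `-mu` (the lowest weight) in the dual
`𝔤`-module `M_mu^*` that is normalised by `⟨x_mu, x_mu^*⟩ = 1`. -/
structure IsLowestWeightDual (xi : Module.Dual ℂ (VermaModule Δ mu)) : Prop where
  mem_weightSpace : xi ∈ LieModule.weightSpace (L := 𝔥) (Module.Dual ℂ (VermaModule Δ mu)) (⇑(-mu))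
  apply_highestWeightVector : xi (highestWeightVector Δ mu) = 1

/-- The contraction `M ⊗ V → V`, `m ⊗ v ↦ ⟨m, xi⟩ v`, with a linear form `xi` on `M`. -/
def contract {M V : Type*} [AddCommGroup M] [Module ℂ M] [AddCommGroup V] [Module ℂ V]
    (xi : Module.Dual ℂ M) : M ⊗[ℂ] V →ₗ[ℂ] V :=
  (TensorProduct.lid ℂ V).toLinearMap ∘ₗ LinearMap.rTensor V xi

/-- The expectation value `⟨Φ⟩ = ⟨Φ(x_lam), xi⟩ ∈ V` of an intertwining operator
`Φ : M_lam → M_mu ⊗ V`. -/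
def expectation {V : Type*} [AddCommGroup V] [Module ℂ V] [LieRingModule 𝔤 V] [LieModule ℂ 𝔤 V]
    (xi : Module.Dual ℂ (VermaModule Δ mu))
    (Phi : VermaModule Δ lam →ₗ⁅ℂ,𝔤⁆ VermaModule Δ mu ⊗[ℂ] V) : V :=
  contract xi (Phi (highestWeightVector Δ lam))

end Verma

end

/-! ### Straightening of products in a noncommutative algebra -/

section Straightening

variable {R A ι : Type*} [CommRing R] [Ring A] [Algebra R A] {x : ι → A}

/-! By Frobenius reciprocity (`hom_ext`, `exists_hom`), an intertwiner M_λ → M_μ ⊗ V is the same as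
a vector w of weight λ in M_μ ⊗ V killed by 𝔫₊. Contraction obeys a Leibniz rule (`contract_lie`),
so for such w, contracting with u x_μ^* gives u⟨w⟩ for every product u of positive root vectors,
where ⟨w⟩ is the contraction with x_μ^*. The span of the forms u x_μ^* is 𝔤-stable, because 𝔫₋ kills
x_μ^* and 𝔥 scales it. Its common kernel in M_μ is therefore a submodule, and it omits x_μ; if M_μ
is irreducible the kernel vanishes and these forms separate points
(`eq_zero_of_dualVector_eq_zero`). Hence ⟨w⟩ determines w, which is injectivity.

For surjectivity one needs, given v of weight λ - μ, some w whose contraction with u x_μ^* is u v.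
In each height, the ordered monomials e^b and f^a are indexed by the same finite set of multisets,
so separation of points makes the square matrix of pairings between e^b x_μ^* and f^a x_μ
invertible. This yields vectors m_a in M_μ dual to the forms e^b x_μ^* (`exists_dual_vector`). Then
w = ∑ m_a ⊗ e^a v works; the sum is finite because V is finite-dimensional. Separation of points
again shows that w has weight λ and is killed by 𝔫₊ (`exists_singular_vector`).

Both this count and the existence of x_μ^* need the f^a x_μ to be a basis of M_μ, hence the
Poincaré–Birkhoff–Witt theorem for 𝔤. Its spanning half is straightening. Its independence half lets
𝔤 act by vector fields on a representation space, independent at one point, and compares leading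
symbols of differential operators (`Derivation.linearIndependent_prod_map`). -/

theorem prod_map_sub_prod_map_mem_span_of_perm
    (hx : ∀ i j, x i * x j - x j * x i ∈ Submodule.span R (Set.range x))
    {l l' : List ι} (h : l.Perm l') :
    (l.map x).prod - (l'.map x).prod ∈
      Submodule.span R {p | ∃ m : List ι, m.length < l.length ∧ (m.map x).prod = p} := by
  induction h with
  | nil => simp
  | @cons i l l' _ ih =>
    simp only [List.map_cons, List.prod_cons, ← mul_sub]
    generalize (l.map x).prod - (l'.map x).prod = z at ih ⊢
    induction ih using Submodule.span_induction with
    | mem p hp =>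
      obtain ⟨m, hm, rfl⟩ := hp
      exact Submodule.subset_span ⟨i :: m, by simpa using hm, by simp⟩
    | zero => simp
    | add p q _ _ hp hq => rw [mul_add]; exact add_mem hp hq
    | smul r p _ hp => rw [mul_smul_comm]; exact Submodule.smul_mem _ _ hp
  -- Exchanging neighbours costs a commutator, a combination of single generators, so the error has
  -- one factor fewer.
  | swap i j l =>
    simp only [List.map_cons, List.prod_cons, ← mul_assoc, ← sub_mul]
    have hz := hx j i
    generalize x j * x i - x i * x j = z at hz ⊢
    induction hz using Submodule.span_induction with
    | mem p hp =>
      obtain ⟨k, rfl⟩ := hp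
      exact Submodule.subset_span ⟨k :: l, by simp, by simp⟩
    | zero => simp
    | add p q _ _ hp hq => rw [add_mul]; exact add_mem hp hq
    | smul r p _ hp => rw [smul_mul_assoc]; exact Submodule.smul_mem _ _ hp
  | @trans l₁ l₂ l₃ h₁ _ ih₁ ih₂ =>
    rw [← h₁.length_eq] at ih₂
    simpa using add_mem ih₁ ih₂

/-- If the commutators of the `x i` are linear combinations of the `x i`, then all products of the
`x i` are linear combinations of products in which the order of the factors is prescribed. -/
theorem prod_map_mem_span_of_commutator_mem
    (hx : ∀ i j, x i * x j - x j * x i ∈ Submodule.span R (Set.range x))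
    {κ : Type*} {r : κ → List ι} (hr : ∀ l, ∃ k, List.Perm l (r k)) (l : List ι) :
    (l.map x).prod ∈ Submodule.span R (Set.range fun k => ((r k).map x).prod) := by
  induction hn : l.length using Nat.strong_induction_on generalizing l with
  | _ n ih =>
    obtain ⟨k, hk⟩ := hr l
    rw [← sub_add_cancel (l.map x).prod ((r k).map x).prod]
    refine add_mem ?_ (Submodule.subset_span ⟨k, rfl⟩)
    refine Submodule.span_le.2 ?_ (prod_map_sub_prod_map_mem_span_of_perm hx hk)
    rintro _ ⟨m, hm, rfl⟩
    exact ih m.length (hn ▸ hm) m rfl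

end Straightening

/-! ### Leading symbols of products of derivations -/

section Symbols

variable {K A ι : Type*} [Field K] [CommRing A] [Algebra K A]

theorem Derivation.apply_mem_pow (D : Derivation K A A) (I : Ideal A) (k : ℕ) {F : A}
    (hF : F ∈ I ^ (k + 1)) : D F ∈ I ^ k := by
  induction k generalizing F with
  | zero => simp
  | succ k ih =>
    rw [pow_succ] at hF
    refine Submodule.mul_induction_on hF (fun a ha b hb => ?_) (fun a b ha hb => ?_)
    · rw [Derivation.leibniz, smul_eq_mul, smul_eq_mul]
      refine add_mem (Ideal.mul_mem_right _ _ ha) ?_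
      rw [mul_comm, pow_succ]
      exact Ideal.mul_mem_mul (ih ha) hb
    · rw [map_add]; exact add_mem ha hb

variable (D : ι → Derivation K A A)

theorem Derivation.prod_map_apply_mem_pow (I : Ideal A) (l : List ι) (k : ℕ) {F : A}
    (hF : F ∈ I ^ (k + l.length)) :
    (l.map fun i => (D i : Module.End K A)).prod F ∈ I ^ k := by
  induction l generalizing k with
  | nil => simpa using hF
  | cons i l ih =>
    rw [List.map_cons, List.prod_cons, Module.End.mul_apply]
    exact (D i).apply_mem_pow I k (ih (k + 1) (by
      rwa [List.length_cons, add_comm l.length, ← add_assoc] at hF))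

variable {D} {ε : A →ₐ[K] K} {f : ι → A}

theorem multiset_prod_mem_ker_pow (hf : ∀ i, ε (f i) = 0) (s : Multiset ι) :
    (s.map f).prod ∈ RingHom.ker ε ^ s.card := by
  induction s using Multiset.induction_on with
  | empty => simp
  | cons a s ih =>
    rw [Multiset.map_cons, Multiset.prod_cons, Multiset.card_cons, pow_succ']
    exact Ideal.mul_mem_mul (hf a) ih

variable [DecidableEq ι]

/-- With the f i as local coordinates at the point ε, D j agrees with ∂/∂f_j to leading order: on a
monomial of degree n the error vanishes to order n rather than n - 1. -/
theorem Derivation.apply_multiset_prod_sub_mem (hf : ∀ i, ε (f i) = 0)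
    (hD : ∀ i j, ε (D j (f i)) = if i = j then 1 else 0) (j : ι) (s : Multiset ι) :
    D j (s.map f).prod - s.count j • ((s.erase j).map f).prod ∈ RingHom.ker ε ^ s.card := by
  induction s using Multiset.induction_on with
  | empty => simp
  | cons a s ih =>
    rw [Multiset.map_cons, Multiset.prod_cons, Derivation.leibniz, smul_eq_mul, smul_eq_mul,
      Multiset.card_cons]
    have h1 : f a * (D j (s.map f).prod - s.count j • ((s.erase j).map f).prod) ∈
        RingHom.ker ε ^ (s.card + 1) := by
      rw [pow_succ']; exact Ideal.mul_mem_mul (hf a) ih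
    have h2 : (s.map f).prod * (D j (f a) - if a = j then 1 else 0) ∈
        RingHom.ker ε ^ (s.card + 1) := by
      rw [pow_succ]
      refine Ideal.mul_mem_mul (multiset_prod_mem_ker_pow hf s) ?_
      rw [RingHom.mem_ker, map_sub, hD]
      split_ifs <;> simp
    convert add_mem h1 h2 using 1
    by_cases haj : a = j
    · subst haj
      have h3 : s.count a • (f a * ((s.erase a).map f).prod) = s.count a • (s.map f).prod := by
        by_cases ha : a ∈ s
        · rw [← Multiset.prod_cons, ← Multiset.map_cons, Multiset.cons_erase ha]
        · simp [Multiset.count_eq_zero_of_notMem ha]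
      rw [Multiset.count_cons_self, Multiset.erase_cons_head, mul_sub, mul_smul_comm, h3, if_pos rfl,
        add_smul, one_smul]
      ring
    · rw [Multiset.count_cons_of_ne (Ne.symm haj), Multiset.erase_cons_tail _ haj,
        Multiset.map_cons, Multiset.prod_cons, if_neg haj, mul_sub, mul_smul_comm]
      ring

/-- The rightmost operator acts first. Its error term vanishes to order `l.length + 1`, so the
remaining operators cannot bring it out of the kernel of ε. -/
theorem Derivation.prod_map_concat_apply (hf : ∀ i, ε (f i) = 0)
    (hD : ∀ i j, ε (D j (f i)) = if i = j then 1 else 0) (l : List ι) (j : ι) (s : Multiset ι)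
    (hs : l.length + 1 = s.card) :
    ε (((l ++ [j]).map fun i => (D i : Module.End K A)).prod (s.map f).prod) =
      s.count j • ε ((l.map fun i => (D i : Module.End K A)).prod ((s.erase j).map f).prod) := by
  have h := Derivation.apply_multiset_prod_sub_mem hf hD j s
  rw [← hs, add_comm] at h
  have h' := Derivation.prod_map_apply_mem_pow D _ l 1 h
  rw [pow_one, RingHom.mem_ker, map_sub, map_sub, sub_eq_zero, map_nsmul, map_nsmul] at h'
  simpa using h'

theorem Derivation.prod_map_apply_eq_zero (hf : ∀ i, ε (f i) = 0)
    (hD : ∀ i j, ε (D j (f i)) = if i = j then 1 else 0) (l : List ι) (s : Multiset ι)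
    (hs : l.length ≤ s.card) (hl : (l : Multiset ι) ≠ s) :
    ε ((l.map fun i => (D i : Module.End K A)).prod (s.map f).prod) = 0 := by
  rcases hs.lt_or_eq with hs | hs
  · have := Derivation.prod_map_apply_mem_pow D _ l 1 (Ideal.pow_le_pow_right
      (by omega : 1 + l.length ≤ s.card) (multiset_prod_mem_ker_pow hf s))
    rwa [pow_one] at this
  induction l using List.reverseRecOn generalizing s with
  | nil => exact absurd (Multiset.card_eq_zero.1 hs.symm).symm hl
  | append_singleton l j ih =>
    rw [List.length_append, List.length_singleton] at hs
    have hc : ∀ h : j ∈ s, l.length = (s.erase j).card := fun h => by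
      have := Multiset.card_erase_add_one h
      omega
    rw [Derivation.prod_map_concat_apply hf hD l j s hs]
    by_cases hj : j ∈ s
    · rw [ih (s.erase j) (hc hj).le ?_ (hc hj), smul_zero]
      rintro h
      apply hl
      rw [← Multiset.coe_add, h, Multiset.coe_singleton, add_comm, Multiset.singleton_add,
        Multiset.cons_erase hj]
    · rw [Multiset.count_eq_zero_of_notMem hj, zero_smul]

/-- The value is the product of the factorials of the multiplicities in `l`, whence characteristic
zero. -/
theorem Derivation.prod_map_apply_self_ne_zero [CharZero K] (hf : ∀ i, ε (f i) = 0)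
    (hD : ∀ i j, ε (D j (f i)) = if i = j then 1 else 0) (l : List ι) :
    ε ((l.map fun i => (D i : Module.End K A)).prod ((l : Multiset ι).map f).prod) ≠ 0 := by
  induction l using List.reverseRecOn with
  | nil => simp
  | append_singleton l j ih =>
    rw [Derivation.prod_map_concat_apply hf hD l j _ (by simp)]
    have h : ((l ++ [j] : List ι) : Multiset ι) = j ::ₘ (l : Multiset ι) := by
      rw [← Multiset.coe_add, Multiset.coe_singleton, add_comm, Multiset.singleton_add]
    rw [h, Multiset.count_cons_self, Multiset.erase_cons_head, nsmul_eq_mul]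
    exact mul_ne_zero (Nat.cast_ne_zero.2 (Nat.succ_ne_zero _)) ih

/-- In a linear relation, take a monomial of maximal length and test on the polynomial of the same
multidegree in the f i: every other term vanishes at ε. -/
theorem Derivation.linearIndependent_prod_map [CharZero K] (hf : ∀ i, ε (f i) = 0)
    (hD : ∀ i j, ε (D j (f i)) = if i = j then 1 else 0) {κ : Type*} {r : κ → List ι}
    (hr : Function.Injective fun k => (r k : Multiset ι)) :
    LinearIndependent K fun k => ((r k).map fun i => (D i : Module.End K A)).prod := by
  rw [linearIndependent_iff]
  intro c hc
  by_contra hne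
  obtain ⟨k, hk, hmax⟩ := c.support.exists_max_image (fun k => (r k).length)
    (Finsupp.support_nonempty_iff.2 hne)
  have h := congrArg (fun T : Module.End K A => ε (T ((r k : Multiset ι).map f).prod)) hc
  simp only [Finsupp.linearCombination_apply, Finsupp.sum, LinearMap.sum_apply, map_sum,
    LinearMap.smul_apply, LinearMap.zero_apply, map_zero, ε.map_smul_of_tower] at h
  rw [Finset.sum_eq_single k] at h
  · exact (smul_ne_zero (Finsupp.mem_support_iff.1 hk)
      (Derivation.prod_map_apply_self_ne_zero hf hD (r k))) h
  · intro k' hk' hkk'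
    rw [Derivation.prod_map_apply_eq_zero hf hD _ _ (by simpa using hmax k' hk')
      (fun h => hkk' (hr h)), smul_zero]
  · exact fun h => absurd hk h

end Symbols

/-! ### The Poincaré–Birkhoff–Witt theorem: spanning -/

namespace UniversalEnvelopingAlgebra

section Adjoin

variable {R L : Type*} [CommRing R] [LieRing L] [LieAlgebra R L]

attribute [local instance 100] LieRing.ofAssociativeRing

theorem ι_lie (x y : L) : ι R ⁅x, y⁆ = ι R x * ι R y - ι R y * ι R x := by
  rw [LieHom.map_lie, LieRing.of_associative_ring_bracket]

/-- The universal property retracts U(L) onto the subalgebra generated by L; followed by the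
inclusion, the retraction fixes L and so is the identity. -/
theorem adjoin_range_ι : Algebra.adjoin R (Set.range (ι R : L → _)) = ⊤ := by
  let S := Algebra.adjoin R (Set.range (ι R : L → UniversalEnvelopingAlgebra R L))
  let g : L →ₗ⁅R⁆ S :=
    { toFun := fun x => ⟨ι R x, Algebra.subset_adjoin ⟨x, rfl⟩⟩
      map_add' := fun x y => Subtype.ext (map_add _ x y)
      map_smul' := fun t x => Subtype.ext (map_smul _ t x)
      map_lie' := fun {x y} => Subtype.ext (ι_lie x y) }
  have h : S.val.comp (lift R g) = AlgHom.id R _ := by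
    apply hom_ext
    ext x
    change S.val (lift R g (ι R x)) = ι R x
    rw [lift_ι_apply]
    rfl
  refine eq_top_iff.2 fun u _ => ?_
  have := DFunLike.congr_fun h u
  change ((lift R g u : S) : UniversalEnvelopingAlgebra R L) = u at this
  rw [← this]
  exact (lift R g u).2

theorem ι_mem_span {ι' : Type*} {x : ι' → L} {z : L} (hz : z ∈ Submodule.span R (Set.range x)) :
    ι R z ∈ Submodule.span R (Set.range fun i => ι R (x i)) := by
  have := Submodule.mem_map_of_mem (f := (ι R : L →ₗ⁅R⁆ _).toLinearMap) hz
  rw [Submodule.map_span, ← Set.range_comp] at this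
  exact this

/-- The spanning half of the Poincaré–Birkhoff–Witt theorem. -/
theorem span_prod_map_eq_top {ι' κ : Type*} {x : ι' → L} (hx : Submodule.span R (Set.range x) = ⊤)
    {r : κ → List ι'} (hr : ∀ l, ∃ k, List.Perm l (r k)) :
    Submodule.span R (Set.range fun k => ((r k).map fun i => ι R (x i)).prod) = ⊤ := by
  set P := Submodule.span R (Set.range fun k => ((r k).map fun i => ι R (x i)).prod)
  have hι : ∀ z : L, ι R z ∈ Submodule.span R (Set.range fun i => ι R (x i)) := fun z =>
    ι_mem_span (hx ▸ Submodule.mem_top)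
  have hl : ∀ l : List ι', (l.map fun i => ι R (x i)).prod ∈ P := fun l =>
    prod_map_mem_span_of_commutator_mem (fun i j => by rw [← ι_lie]; exact hι _) hr l
  have hone : (1 : UniversalEnvelopingAlgebra R L) ∈ P := by simpa using hl []
  -- It suffices that P contains 1 and is stable under left multiplication by L, since L generates
  -- the algebra.
  have hmul : ∀ (z : L), ∀ u ∈ P, ι R z * u ∈ P := by
    intro z u hu
    have hz := hι z
    generalize ι R z = z at hz ⊢
    induction hz using Submodule.span_induction with
    | mem p hp =>
      obtain ⟨i, rfl⟩ := hp
      induction hu using Submodule.span_induction with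
      | mem u hu =>
        obtain ⟨k, rfl⟩ := hu
        simpa using hl (i :: r k)
      | zero => simp
      | add p q _ _ hp hq => rw [mul_add]; exact add_mem hp hq
      | smul t p _ hp => rw [mul_smul_comm]; exact Submodule.smul_mem _ _ hp
    | zero => simp
    | add p q _ _ hp hq => rw [add_mul]; exact add_mem hp hq
    | smul t p _ hp => rw [smul_mul_assoc]; exact Submodule.smul_mem _ _ hp
  refine Submodule.eq_top_iff'.2 fun u => ?_
  suffices h : ∀ v ∈ P, u * v ∈ P by simpa using h 1 hone
  have hu : u ∈ Algebra.adjoin R (Set.range (ι R : L → UniversalEnvelopingAlgebra R L)) :=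
    by rw [adjoin_range_ι]; exact Algebra.mem_top
  induction hu using Algebra.adjoin_induction with
  | mem u hu => obtain ⟨z, rfl⟩ := hu; exact hmul z
  | algebraMap t => intro v hv; rw [← Algebra.smul_def]; exact Submodule.smul_mem _ _ hv
  | add p q _ _ hp hq => intro v hv; rw [add_mul]; exact add_mem (hp v hv) (hq v hv)
  | mul p q _ _ hp hq => intro v hv; rw [mul_assoc]; exact hp _ (hq v hv)

end Adjoin

/-! ### The Poincaré–Birkhoff–Witt theorem: independence -/

noncomputable section Independence

variable {K L W σ : Type*} [Field K] [LieRing L] [LieAlgebra K L] [AddCommGroup W] [Module K W]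

attribute [local instance 100] LieRing.ofAssociativeRing

/-- The elements of `W` as linear polynomials in the vectors of a basis. -/
def linearPolynomial (B : Module.Basis σ K W) : W →ₗ[K] MvPolynomial σ K :=
  B.constr K MvPolynomial.X

theorem linearPolynomial_basis (B : Module.Basis σ K W) (s : σ) :
    linearPolynomial B (B s) = MvPolynomial.X s := by
  simp [linearPolynomial]

/-- The derivation of the polynomial ring which extends an endomorphism of the space of
linear polynomials. -/
def polynomialDerivation (B : Module.Basis σ K W) (T : Module.End K W) :
    Derivation K (MvPolynomial σ K) (MvPolynomial σ K) :=
  MvPolynomial.mkDerivation K fun s => linearPolynomial B (T (B s))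

theorem polynomialDerivation_linearPolynomial (B : Module.Basis σ K W) (T : Module.End K W)
    (w : W) : polynomialDerivation B T (linearPolynomial B w) = linearPolynomial B (T w) := by
  suffices h : (polynomialDerivation B T : MvPolynomial σ K →ₗ[K] MvPolynomial σ K) ∘ₗ
      linearPolynomial B = linearPolynomial B ∘ₗ T from LinearMap.congr_fun h w
  refine B.ext fun s => ?_
  simp [linearPolynomial_basis, polynomialDerivation]

/-- A representation `W` of `L` extends to an action of `L` on polynomials by derivations. -/
def polynomialAction (B : Module.Basis σ K W) (ρ : L →ₗ⁅K⁆ Module.End K W) :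
    L →ₗ⁅K⁆ Module.End K (MvPolynomial σ K) where
  toFun x := polynomialDerivation B (ρ x)
  map_add' x y := by
    rw [← Derivation.coe_add_linearMap]
    congr 1
    exact MvPolynomial.derivation_ext fun s => by simp [polynomialDerivation]
  map_smul' t x := by
    rw [RingHom.id_apply, ← Derivation.coe_smul_linearMap]
    congr 1
    exact MvPolynomial.derivation_ext fun s => by simp [polynomialDerivation]
  map_lie' {x y} := by
    change _ = ⁅(polynomialDerivation B (ρ x) : Module.End K (MvPolynomial σ K)),
      (polynomialDerivation B (ρ y) : Module.End K (MvPolynomial σ K))⁆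
    rw [← Derivation.commutator_coe_linear_map]
    congr 1
    refine MvPolynomial.derivation_ext fun s => ?_
    rw [← linearPolynomial_basis B s, Derivation.commutator_apply]
    simp only [polynomialDerivation_linearPolynomial, LieHom.map_lie,
      LieRing.of_associative_ring_bracket, LinearMap.sub_apply, Module.End.mul_apply, map_sub]

variable [CharZero K]

/-- Polynomials in W are functions on W*, on which L acts by vector fields. The hypothesis on p says
that the infinitesimal stabilizer of the point p is trivial, so a basis of L gives independent
tangent vectors at p. -/
theorem linearIndependent_prod_map_of_stabilizer [FiniteDimensional K W]
    (ρ : L →ₗ⁅K⁆ Module.End K W) (p : Module.Dual K W)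
    (hp : ∀ x, (∀ w, p (ρ x w) = 0) → x = 0) {ι' κ : Type*} (b : Module.Basis ι' K L)
    {r : κ → List ι'} (hr : Function.Injective fun k => (r k : Multiset ι')) :
    LinearIndependent K fun k => ((r k).map fun i => ι K (b i)).prod := by
  classical
  let B := Module.finBasis K W
  let τ : L →ₗ[K] Module.Dual K W :=
    { toFun := fun x => p ∘ₗ ρ x
      map_add' := fun x y => by ext; simp
      map_smul' := fun t x => by ext; simp }
  have hτ : Function.Injective τ := by
    refine (injective_iff_map_eq_zero τ).2 fun x hx => hp x fun w => ?_
    exact LinearMap.congr_fun hx w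
  -- Linear functions whose differentials at p are dual to the tangent vectors of the basis;
  -- subtracting their values at p turns them into local coordinates.
  have hw : ∀ i, ∃ w : W, ∀ x, p (ρ x w) = b.coord i x := fun i => by
    obtain ⟨g, hg⟩ := LinearMap.dualMap_surjective_of_injective hτ (b.coord i)
    refine ⟨(Module.evalEquiv K W).symm g, fun x => ?_⟩
    rw [← hg]
    exact Module.apply_evalEquiv_symm_apply _ _ (τ x) g
  choose w hw using hw
  let ε : MvPolynomial (Fin (Module.finrank K W)) K →ₐ[K] K := MvPolynomial.aeval fun s => p (B s)
  have hε : ∀ v, ε (linearPolynomial B v) = p v := fun v => by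
    suffices h : ε.toLinearMap ∘ₗ linearPolynomial B = p from LinearMap.congr_fun h v
    refine B.ext fun s => ?_
    simp [linearPolynomial_basis, ε]
  have h := Derivation.linearIndependent_prod_map
    (D := fun i => polynomialDerivation B (ρ (b i))) (ε := ε)
    (f := fun i => linearPolynomial B (w i) - algebraMap K _ (p (w i)))
    (fun i => by rw [map_sub, hε, AlgHom.commutes]; simp)
    (fun i j => by
      rw [map_sub, Derivation.map_algebraMap, sub_zero, polynomialDerivation_linearPolynomial, hε,
        hw, Module.Basis.coord_apply, Module.Basis.repr_self, Finsupp.single_apply]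
      simp only [eq_comm]) hr
  refine LinearIndependent.of_comp (lift K (polynomialAction B ρ)).toLinearMap ?_
  have : (lift K (polynomialAction B ρ)).toLinearMap ∘
      (fun k => ((r k).map fun i => ι K (b i)).prod) = fun k => ((r k).map fun i =>
        (polynomialDerivation B (ρ (b i)) : Module.End K (MvPolynomial _ K))).prod := by
    ext1 k
    simp only [AlgHom.toLinearMap_apply, map_list_prod, List.map_map, Function.comp_def,
      lift_ι_apply]
    rfl
  rw [this]
  exact h

/-- The independence half of the Poincaré–Birkhoff–Witt theorem, for Lie algebras with trivial
centre over fields of characteristic zero. -/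
theorem linearIndependent_prod_map [FiniteDimensional K L]
    (hL : ∀ x : L, (∀ y : L, ⁅x, y⁆ = 0) → x = 0) {ι' κ : Type*} (b : Module.Basis ι' K L)
    {r : κ → List ι'} (hr : Function.Injective fun k => (r k : Multiset ι')) :
    LinearIndependent K fun k => ((r k).map fun i => ι K (b i)).prod := by
  -- L acts on End L by left composition with ad, and the point is the trace. On the rank one
  -- operator g ⊗ y the pairing is g([x, y]), so the stabilizer is the centre.
  let ρ : L →ₗ⁅K⁆ Module.End K (Module.End K L) :=
    { toFun := fun x => LinearMap.mulLeft K (LieAlgebra.ad K L x)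
      map_add' := fun x y => by ext; simp
      map_smul' := fun t x => by ext; simp
      map_lie' := fun {x y} => by
        ext T v
        simp [LieRing.of_associative_ring_bracket, LinearMap.mulLeft] }
  refine linearIndependent_prod_map_of_stabilizer ρ (LinearMap.trace K L) (fun x hx => ?_) b hr
  refine hL x fun y => ?_
  rw [← Module.forall_dual_apply_eq_zero_iff K]
  intro g
  have h := hx (g.smulRight y)
  have h' : ρ x (g.smulRight y) = g.smulRight ⁅x, y⁆ := by
    ext v
    simp [ρ]
  rwa [h', LinearMap.trace_smulRight] at h

end Independence

end UniversalEnvelopingAlgebra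

/-! ### Root vectors and the height grading -/

noncomputable section

namespace Verma

open LieAlgebra LieAlgebra.IsKilling

variable {𝔤 : Type*} [LieRing 𝔤] [LieAlgebra ℂ 𝔤] [FiniteDimensional ℂ 𝔤] [IsKilling ℂ 𝔤]
  {𝔥 : LieSubalgebra ℂ 𝔤} [𝔥.IsCartanSubalgebra]

theorem cartan_le_borel (Δ : RootPairing.Base (rootSystem 𝔥)) {x : 𝔤} (hx : x ∈ 𝔥) :
    x ∈ borel Δ :=
  Submodule.mem_sup_left (S := 𝔥.toSubmodule) (T := nPos Δ) hx

theorem nPos_le_borel (Δ : RootPairing.Base (rootSystem 𝔥)) {x : 𝔤} (hx : x ∈ nPos Δ) :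
    x ∈ borel Δ :=
  Submodule.mem_sup_right (S := 𝔥.toSubmodule) (T := nPos Δ) hx

/-- Root vectors `e j`, `f j` for the positive roots and their negatives, together with an element
`level` of the Cartan subalgebra on which the positive roots take positive integral values. -/
structure RootVectors (Δ : RootPairing.Base (rootSystem 𝔥)) (J : Type*) where
  root : J → Module.Dual ℂ 𝔥
  e : J → 𝔤
  f : J → 𝔤
  level : 𝔥
  ht : J → ℕ
  lie_e : ∀ (h : 𝔥) j, ⁅(h : 𝔤), e j⁆ = root j h • e j
  lie_f : ∀ (h : 𝔥) j, ⁅(h : 𝔤), f j⁆ = (-root j) h • f j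
  span_e : Submodule.span ℂ (Set.range e) = nPos Δ
  span_f_sup_borel : Submodule.span ℂ (Set.range f) ⊔ (borel Δ).toSubmodule = ⊤
  eq_zero_of_sum_mem_borel : ∀ (s : Finset J) (c : J → ℂ), ∑ j ∈ s, c j • f j ∈ borel Δ →
    ∀ j ∈ s, c j = 0
  root_level : ∀ j, root j level = ht j
  ht_ne_zero : ∀ j, ht j ≠ 0

/-- The simple roots form a basis of 𝔥*, so some h in 𝔥 takes the value 1 on each of them. -/
theorem exists_apply_eq_height (Δ : RootPairing.Base (rootSystem 𝔥)) :
    ∃ h : 𝔥, ∀ α : 𝔥.root, (α : LieModule.Weight ℂ 𝔥 𝔤) h = (Δ.height α : ℂ) := by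
  let φ : Module.Dual ℂ (Module.Dual ℂ 𝔥) := Δ.toWeightBasis.constr ℂ fun _ => (1 : ℂ)
  refine ⟨(Module.evalEquiv ℂ 𝔥).symm φ, fun α => ?_⟩
  have h1 : (α : LieModule.Weight ℂ 𝔥 𝔤) ((Module.evalEquiv ℂ 𝔥).symm φ) =
      φ ((rootSystem 𝔥).root α) :=
    Module.apply_evalEquiv_symm_apply ℂ 𝔥 ((rootSystem 𝔥).root α) φ
  obtain ⟨c, -, -, hc⟩ := Δ.exists_root_eq_sum_int α
  rw [h1, RootPairing.Base.height_eq_sum hc, hc, map_sum, Int.cast_sum]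
  refine Finset.sum_congr rfl fun j hj => ?_
  have h2 : φ ((rootSystem 𝔥).root j) = 1 := by
    have := Δ.toWeightBasis.constr_basis ℂ (fun _ => (1 : ℂ)) ⟨j, hj⟩
    rwa [RootPairing.Base.toWeightBasis_apply] at this
  rw [map_zsmul, h2, zsmul_eq_mul, mul_one]

/-- The vectors come from 𝔰𝔩₂-triples. Independence of the f modulo 𝔟 is read off from the Killing
form: e_α is orthogonal to 𝔟 and to every f_β with β ≠ α, but not to f_α. -/
theorem exists_rootVectors (Δ : RootPairing.Base (rootSystem 𝔥)) :
    Nonempty (RootVectors Δ {α : 𝔥.root // Δ.IsPos α}) := by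
  classical
  obtain ⟨H, hH⟩ := exists_apply_eq_height Δ
  have hnz : ∀ α : 𝔥.root, (α : LieModule.Weight ℂ 𝔥 𝔤).IsNonZero :=
    LieSubalgebra.isNonZero_coe_root
  choose h e f ht he hf using fun α : 𝔥.root => exists_isSl2Triple_of_weight_isNonZero (hnz α)
  have hspan : ∀ (α : LieModule.Weight ℂ 𝔥 𝔤), α.IsNonZero → ∀ x ∈ rootSpace 𝔥 α, x ≠ 0 →
      ∀ y ∈ rootSpace 𝔥 α, ∃ c : ℂ, y = c • x := by
    intro α hα x hx hx0 y hy
    obtain ⟨c, hc⟩ := (finrank_eq_one_iff_of_nonzero' (⟨x, hx⟩ : rootSpace 𝔥 α)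
      (fun h => hx0 (congrArg Subtype.val h))).1 (finrank_rootSpace_eq_one α hα) ⟨y, hy⟩
    exact ⟨c, (congrArg Subtype.val hc).symm⟩
  have hkill : ∀ α : 𝔥.root, killingForm ℂ 𝔤 (e α) (f α) ≠ 0 := fun α h0 => by
    have h1 := lie_eq_killingForm_smul_of_mem_rootSpace_of_mem_rootSpace_neg (he α) (hf α)
    rw [h0, zero_smul, (ht α).lie_e_f] at h1
    exact (ht α).h_ne_zero h1
  have happly : ∀ α β : 𝔥.root, α ≠ β → killingForm ℂ 𝔤 (e α) (f β) = 0 := fun α β hne => by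
    refine killingForm_apply_eq_zero_of_mem_rootSpace_of_add_ne_zero ℂ 𝔤 𝔥 (he α) (hf β) ?_
    intro h0
    refine hne (Subtype.ext (LieModule.Weight.ext fun x => ?_))
    have := congrFun h0 x
    simpa [add_neg_eq_zero] using this
  have hborel : ∀ (α : 𝔥.root), Δ.IsPos α → ∀ x ∈ borel Δ, killingForm ℂ 𝔤 (e α) x = 0 := by
    intro α hα x hx
    obtain ⟨a, ha, n, hn, rfl⟩ := Submodule.mem_sup.1 hx
    rw [map_add]
    have h1 : killingForm ℂ 𝔤 (e α) a = 0 := by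
      refine killingForm_apply_eq_zero_of_mem_rootSpace_of_add_ne_zero ℂ 𝔤 𝔥 (β := 0) (he α)
        (le_zeroRootSubalgebra ℂ 𝔤 𝔥 ha) ?_
      rw [add_zero]; exact hnz α
    have h2 : killingForm ℂ 𝔤 (e α) n = 0 := by
      refine nPos_induction Δ (p := fun n => killingForm ℂ 𝔤 (e α) n = 0) (fun β hβ y hy => ?_)
        (map_zero _) (fun a b ha hb => by rw [map_add, ha, hb, add_zero]) hn
      refine killingForm_apply_eq_zero_of_mem_rootSpace_of_add_ne_zero ℂ 𝔤 𝔥 (he α) hy ?_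
      intro h0
      have h3 := congrFun h0 H
      simp only [Pi.add_apply, Pi.zero_apply, hH] at h3
      rw [RootPairing.Base.isPos_iff] at hα hβ
      have h4 : Δ.height α + Δ.height β = 0 := by exact_mod_cast h3
      omega
    rw [h1, h2, add_zero]
  refine ⟨{
    root := fun j => (rootSystem 𝔥).root j.1
    e := fun j => e j.1
    f := fun j => f j.1
    level := H
    ht := fun j => (Δ.height j.1).toNat
    lie_e := fun t j => lie_eq_smul_of_mem_rootSpace (he j.1) t
    lie_f := fun t j => lie_eq_smul_of_mem_rootSpace (hf j.1) t
    span_e := ?_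
    span_f_sup_borel := ?_
    eq_zero_of_sum_mem_borel := ?_
    root_level := fun j => ?_
    ht_ne_zero := fun j => ?_ }⟩
  · refine le_antisymm (Submodule.span_le.2 ?_) fun x hx => ?_
    · rintro _ ⟨j, rfl⟩
      exact rootSpace_le_nPos Δ j.2 (he j.1)
    · refine nPos_induction Δ (p := fun x => x ∈ Submodule.span ℂ (Set.range _)) (fun β hβ y hy => ?_)
        (zero_mem _) (fun a b ha hb => add_mem ha hb) hx
      obtain ⟨c, rfl⟩ := hspan β (hnz β) _ (he β) (ht β).e_ne_zero y hy
      exact Submodule.smul_mem _ _ (Submodule.subset_span ⟨⟨β, hβ⟩, rfl⟩)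
  · have htop := congrArg LieSubmodule.toSubmodule (cartan_sup_iSup_rootSpace_eq_top (H := 𝔥) (K := ℂ) (L := 𝔤))
    rw [eq_top_iff, ← LieSubmodule.top_toSubmodule (R := ℂ) (L := 𝔥), ← htop]
    simp only [LieSubmodule.sup_toSubmodule, LieSubmodule.iSup_toSubmodule]
    refine sup_le (fun x hx => Submodule.mem_sup_right (cartan_le_borel Δ hx))
      (iSup₂_le fun α hα x hx => ?_)
    let β : 𝔥.root := ⟨α, by simpa using hα⟩
    let := (rootSystem 𝔥).indexNeg
    rcases RootPairing.Base.IsPos.or_neg Δ β with hβ | hβ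
    · exact Submodule.mem_sup_right (nPos_le_borel Δ (rootSpace_le_nPos Δ (α := β) hβ hx))
    -- The root space of a negative root β is spanned by the f of the positive root -β.
    · have hneg : -(((-β : 𝔥.root) : LieModule.Weight ℂ 𝔥 𝔤) : 𝔥 → ℂ) = α := by
        have h1 : (rootSystem 𝔥).root (-β) = -(rootSystem 𝔥).root β := by
          rw [RootPairing.indexNeg_neg, RootPairing.root_reflectionPerm,
            RootPairing.reflection_apply_self]
        ext t
        have h2 := LinearMap.congr_fun h1 t
        simp only [rootSystem_root_apply, LinearMap.neg_apply] at h2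
        simpa [neg_eq_iff_eq_neg] using h2
      have hf' := hf (-β)
      rw [hneg] at hf'
      obtain ⟨c, rfl⟩ := hspan α hα _ hf' (ht (-β)).f_ne_zero x hx
      exact Submodule.mem_sup_left
        (Submodule.smul_mem _ _ (Submodule.subset_span ⟨⟨-β, hβ⟩, rfl⟩))
  · intro s c hs j hj
    have h1 := hborel j.1 j.2 _ hs
    rw [map_sum, Finset.sum_eq_single j] at h1
    · rw [map_smul, smul_eq_mul] at h1
      exact (mul_eq_zero.1 h1).resolve_right (hkill j.1)
    · intro k _ hk
      rw [map_smul, happly _ _ (fun h => hk (Subtype.ext h.symm)), smul_zero]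
    · exact fun h => absurd hj h
  · have h1 := hH j.1
    have h2 : ((Δ.height j.1).toNat : ℤ) = Δ.height j.1 :=
      Int.toNat_of_nonneg ((RootPairing.Base.isPos_iff Δ).1 j.2).le
    change (j.1 : LieModule.Weight ℂ 𝔥 𝔤) H = _
    rw [h1]
    exact_mod_cast congrArg (Int.cast : ℤ → ℂ) h2.symm
  · have := (RootPairing.Base.isPos_iff Δ).1 j.2
    simp only [ne_eq, Int.toNat_eq_zero]
    omega

end Verma

end

/-! ### Action of the enveloping algebra and Frobenius reciprocity -/

noncomputable section

section EnvelopingAction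

variable {R L : Type*} [CommRing R] [LieRing L] [LieAlgebra R L]

attribute [local instance 100] LieRing.ofAssociativeRing

variable (R L) in
/-- The action of the universal enveloping algebra on a Lie module. -/
def envAct (N : Type*) [AddCommGroup N] [Module R N] [LieRingModule L N] [LieModule R L N] :
    UniversalEnvelopingAlgebra R L →ₐ[R] Module.End R N :=
  UniversalEnvelopingAlgebra.lift R (LieModule.toEnd R L N)

variable {N N' : Type*} [AddCommGroup N] [Module R N] [LieRingModule L N] [LieModule R L N]
  [AddCommGroup N'] [Module R N'] [LieRingModule L N'] [LieModule R L N']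

theorem envAct_ι (z : L) (n : N) : envAct R L N (UniversalEnvelopingAlgebra.ι R z) n = ⁅z, n⁆ := by
  rw [envAct, UniversalEnvelopingAlgebra.lift_ι_apply, LieModule.toEnd_apply_apply]

theorem LieModuleHom.map_envAct (Phi : N →ₗ⁅R,L⁆ N') (u : UniversalEnvelopingAlgebra R L) (n : N) :
    Phi (envAct R L N u n) = envAct R L N' u (Phi n) := by
  have hu : u ∈ Algebra.adjoin R
      (Set.range (UniversalEnvelopingAlgebra.ι R : L → UniversalEnvelopingAlgebra R L)) := by
    rw [UniversalEnvelopingAlgebra.adjoin_range_ι]; exact Algebra.mem_top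
  induction hu using Algebra.adjoin_induction generalizing n with
  | mem u hu => obtain ⟨z, rfl⟩ := hu; rw [envAct_ι, envAct_ι, LieModuleHom.map_lie]
  | algebraMap t => simp
  | add p q _ _ hp hq => simp [hp, hq]
  | mul p q _ _ hp hq => simp [hp, hq]

/-- The product in the universal enveloping algebra of the elements `x j`, `j ∈ l`. -/
def word {J : Type*} (x : J → L) (l : List J) : UniversalEnvelopingAlgebra R L :=
  (l.map fun j => UniversalEnvelopingAlgebra.ι R (x j)).prod

variable {J : Type*} (x : J → L)

theorem envAct_word_nil (n : N) : envAct R L N (word x []) n = n := by simp [word]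

theorem envAct_word_cons (j : J) (l : List J) (n : N) :
    envAct R L N (word x (j :: l)) n = ⁅x j, envAct R L N (word x l) n⁆ := by
  simp [word, ← envAct_ι (R := R)]

/-- The weight of a product of weight vectors applied to a weight vector. -/
theorem lie_envAct_word {h : L} {r : J → R} (hx : ∀ j, ⁅h, x j⁆ = r j • x j) {c : R} {n : N}
    (hn : ⁅h, n⁆ = c • n) (l : List J) :
    ⁅h, envAct R L N (word x l) n⁆ = (c + (l.map r).sum) • envAct R L N (word x l) n := by
  induction l with
  | nil => simpa [envAct_word_nil] using hn
  | cons j l ih =>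
    rw [envAct_word_cons, leibniz_lie, ih, hx, smul_lie, lie_smul, ← add_smul, List.map_cons,
      List.sum_cons]
    congr 1
    ring

end EnvelopingAction

namespace Ind

variable {R L : Type*} [CommRing R] [LieRing L] [LieAlgebra R L]
  {𝔨 : LieSubalgebra R L}
  {W : Type*} [AddCommGroup W] [Module R W] [LieRingModule 𝔨 W] [LieModule R 𝔨 W]
  {N : Type*} [AddCommGroup N] [Module R N]

omit [LieModule R 𝔨 W] in
theorem tmul_mul_ι (u : UniversalEnvelopingAlgebra R L) (z : 𝔨) (w : W) :
    tmul R 𝔨 (u * UniversalEnvelopingAlgebra.ι R (z : L)) w = tmul R 𝔨 u ⁅z, w⁆ :=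
  (Submodule.Quotient.eq _).2 (Submodule.subset_span ⟨u, z, w, rfl⟩)

omit [LieModule R 𝔨 W] in
theorem smul_tmul (v u : UniversalEnvelopingAlgebra R L) (w : W) :
    v • tmul R 𝔨 u w = tmul R 𝔨 (v * u) w := by
  rw [tmul, tmul, ← smul_eq_mul, ← TensorProduct.smul_tmul', map_smul]
  rfl

omit [LieModule R 𝔨 W] in
theorem tmul_smul (c : R) (u : UniversalEnvelopingAlgebra R L) (w : W) :
    tmul R 𝔨 u (c • w) = c • tmul R 𝔨 u w := by
  rw [tmul, TensorProduct.tmul_smul]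
  exact ((indRel R 𝔨 W).mkQ.restrictScalars R).map_smul c _

theorem envAct_apply (u : UniversalEnvelopingAlgebra R L) (m : Ind R 𝔨 W) :
    envAct R L (Ind R 𝔨 W) u m = u • m := by
  have hu : u ∈ Algebra.adjoin R
      (Set.range (UniversalEnvelopingAlgebra.ι R : L → UniversalEnvelopingAlgebra R L)) := by
    rw [UniversalEnvelopingAlgebra.adjoin_range_ι]; exact Algebra.mem_top
  induction hu using Algebra.adjoin_induction generalizing m with
  | mem u hu => obtain ⟨z, rfl⟩ := hu; rw [envAct_ι, lie_def]
  | algebraMap t => simp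
  | add p q _ _ hp hq => simp [hp, hq, add_smul]
  | mul p q _ _ hp hq => simp [hp, hq, mul_smul]

omit [LieModule R 𝔨 W] in
theorem induction_on {p : Ind R 𝔨 W → Prop} (m : Ind R 𝔨 W) (tmul : ∀ u w, p (tmul R 𝔨 u w))
    (add : ∀ m m', p m → p m' → p (m + m')) : p m := by
  obtain ⟨t, rfl⟩ := (indRel R 𝔨 W).mkQ_surjective m
  induction t with
  | zero =>
    have := tmul 0 0
    rwa [Ind.tmul, TensorProduct.zero_tmul] at this
  | tmul u w => exact tmul u w
  | add a b ha hb => rw [map_add]; exact add _ _ ha hb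

omit [LieModule R 𝔨 W] in
/-- A linear map on `U(L) ⊗ W` which respects the balancing relations descends to the
induced module. -/
theorem exists_lift (Λ : UniversalEnvelopingAlgebra R L ⊗[R] W →ₗ[R] N)
    (hΛ : ∀ (u : UniversalEnvelopingAlgebra R L) (z : 𝔨) (w : W),
      Λ ((u * UniversalEnvelopingAlgebra.ι R (z : L)) ⊗ₜ w) = Λ (u ⊗ₜ ⁅z, w⁆)) :
    ∃ Λ' : Ind R 𝔨 W →ₗ[R] N, ∀ u w, Λ' (tmul R 𝔨 u w) = Λ (u ⊗ₜ w) := by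
  -- The relations span over U(L) while Λ is only R-linear, so the induction must carry an arbitrary
  -- left multiplier v.
  have h : ∀ t ∈ indRel R 𝔨 W, ∀ v : UniversalEnvelopingAlgebra R L, Λ (v • t) = 0 := by
    intro t ht
    induction ht using Submodule.span_induction with
    | mem t ht =>
      obtain ⟨u, z, w, rfl⟩ := ht
      intro v
      rw [smul_sub, map_sub, TensorProduct.smul_tmul', TensorProduct.smul_tmul', smul_eq_mul,
        smul_eq_mul, ← mul_assoc, hΛ, sub_self]
    | zero => simp
    | add a b _ _ ha hb => intro v; rw [smul_add, map_add, ha, hb, add_zero]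
    | smul u t _ ht => intro v; rw [smul_smul]; exact ht _
  let Λ' : Ind R 𝔨 W →+ N := QuotientAddGroup.lift (indRel R 𝔨 W).toAddSubgroup Λ.toAddMonoidHom
    fun t ht => by simpa using h t ht 1
  refine ⟨{ Λ' with map_smul' := fun c m => ?_ }, fun u w => rfl⟩
  obtain ⟨t, rfl⟩ := (indRel R 𝔨 W).mkQ_surjective m
  exact map_smul Λ c t

variable [LieRingModule L N] [LieModule R L N]

/-- Frobenius reciprocity. -/
theorem exists_lieModuleHom (φ : W →ₗ[R] N) (hφ : ∀ (z : 𝔨) (w : W), φ ⁅z, w⁆ = ⁅(z : L), φ w⁆) :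
    ∃ Phi : Ind R 𝔨 W →ₗ⁅R,L⁆ N, ∀ w, Phi (tmul R 𝔨 1 w) = φ w := by
  obtain ⟨Λ, hΛ⟩ := exists_lift (𝔨 := 𝔨)
    (TensorProduct.lift ((LinearMap.lcomp R N φ) ∘ₗ (envAct R L N).toLinearMap))
    (fun u z w => by
      simp [hφ, ← envAct_ι (R := R) (z : L)])
  have hΛ' : ∀ u w, Λ (tmul R 𝔨 u w) = envAct R L N u (φ w) := fun u w => by simp [hΛ]
  refine ⟨{ Λ with map_lie' := fun {z m} => ?_ }, fun w => by simp [hΛ']⟩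
  change Λ ⁅z, m⁆ = ⁅z, Λ m⁆
  induction m using induction_on with
  | tmul u w => rw [lie_tmul, hΛ', hΛ', map_mul, Module.End.mul_apply, envAct_ι]
  | add m m' hm hm' => rw [lie_add, map_add, map_add, lie_add, hm, hm']

end Ind

end

/-! ### Universal property and monomial basis of Verma modules -/

noncomputable section

namespace Verma

open LieAlgebra LieAlgebra.IsKilling

variable {𝔤 : Type*} [LieRing 𝔤] [LieAlgebra ℂ 𝔤] [FiniteDimensional ℂ 𝔤] [IsKilling ℂ 𝔤]
  {𝔥 : LieSubalgebra ℂ 𝔤} [𝔥.IsCartanSubalgebra]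
  {Δ : RootPairing.Base (rootSystem 𝔥)} {lam mu : Module.Dual ℂ 𝔥}

local notation "U" => UniversalEnvelopingAlgebra ℂ

theorem lie_highestWeightVector {z : 𝔤} (hz : z ∈ borel Δ) :
    ⁅z, highestWeightVector Δ lam⁆ = extend lam z • highestWeightVector Δ lam := by
  rw [highestWeightVector, Ind.lie_tmul, mul_one,
    ← one_mul (UniversalEnvelopingAlgebra.ι ℂ z)]
  have h := Ind.tmul_mul_ι (1 : U 𝔤) (⟨z, hz⟩ : borel Δ) (OneDim.gen Δ lam)
  rwa [OneDim.lie_def, Ind.tmul_smul] at h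

theorem exists_envAct_highestWeightVector (m : VermaModule Δ lam) :
    ∃ u : U 𝔤, envAct ℂ 𝔤 (VermaModule Δ lam) u (highestWeightVector Δ lam) = m := by
  induction m using Ind.induction_on with
  | tmul u w =>
    refine ⟨(show ℂ from w) • u, ?_⟩
    rw [map_smul, LinearMap.smul_apply, Ind.envAct_apply, highestWeightVector, Ind.smul_tmul,
      mul_one]
    have hw : w = (show ℂ from w) • OneDim.gen Δ lam := (mul_one (show ℂ from w)).symm
    conv_rhs => rw [hw, Ind.tmul_smul]
  | add m m' hm hm' =>
    obtain ⟨u, rfl⟩ := hm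
    obtain ⟨u', rfl⟩ := hm'
    exact ⟨u + u', by simp⟩

variable {N : Type*} [AddCommGroup N] [Module ℂ N] [LieRingModule 𝔤 N] [LieModule ℂ 𝔤 N]

theorem hom_ext {Phi Psi : VermaModule Δ lam →ₗ⁅ℂ,𝔤⁆ N}
    (h : Phi (highestWeightVector Δ lam) = Psi (highestWeightVector Δ lam)) : Phi = Psi := by
  ext m
  obtain ⟨u, rfl⟩ := exists_envAct_highestWeightVector m
  rw [LieModuleHom.map_envAct, LieModuleHom.map_envAct, h]

theorem exists_hom {n : N} (hn : ∀ z ∈ borel Δ, ⁅z, n⁆ = extend lam z • n) :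
    ∃ Phi : VermaModule Δ lam →ₗ⁅ℂ,𝔤⁆ N, Phi (highestWeightVector Δ lam) = n := by
  let φ : OneDim Δ lam →ₗ[ℂ] N := LinearMap.toSpanSingleton ℂ N n
  have hφ : ∀ w : OneDim Δ lam, φ w = (show ℂ from w) • n := fun w => rfl
  obtain ⟨Phi, hPhi⟩ := Ind.exists_lieModuleHom (L := 𝔤) (𝔨 := borel Δ) φ (fun z w => by
    rw [OneDim.lie_def, map_smul, hφ, lie_smul, hn _ z.2, smul_comm])
  exact ⟨Phi, by rw [highestWeightVector, hPhi, hφ]; exact one_smul ℂ n⟩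

section Basis

variable {J : Type*} (D : RootVectors Δ J)

/-- The index type of a basis of the Borel subalgebra. -/
abbrev BorelIndex (Δ : RootPairing.Base (rootSystem 𝔥)) : Type _ :=
  Fin (Module.finrank ℂ (borel Δ))

/-- A basis of the Borel subalgebra. -/
def borelBasis (Δ : RootPairing.Base (rootSystem 𝔥)) : Module.Basis (BorelIndex Δ) ℂ (borel Δ) :=
  Module.finBasis ℂ (borel Δ)

/-- The basis of `𝔤` consisting of the negative root vectors and a basis of the
Borel subalgebra. -/
def RootVectors.basis : Module.Basis (J ⊕ BorelIndex Δ) ℂ 𝔤 :=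
  Module.Basis.mk (v := Sum.elim D.f fun k => (borelBasis Δ k : 𝔤))
    (by
      have hb : LinearIndependent ℂ fun k => (borelBasis Δ k : 𝔤) :=
        (borelBasis Δ).linearIndependent.map' (borel Δ).toSubmodule.subtype
          (Submodule.ker_subtype _)
      have hle : Submodule.span ℂ (Set.range fun k => (borelBasis Δ k : 𝔤)) ≤
          (borel Δ).toSubmodule := Submodule.span_le.2 (by rintro _ ⟨k, rfl⟩; exact (borelBasis Δ k).2)
      have hf : LinearIndependent ℂ D.f := linearIndependent_iff'.2 fun s c hs =>
        D.eq_zero_of_sum_mem_borel s c (hs ▸ zero_mem _)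
      refine LinearIndependent.sum_type hf hb (Disjoint.mono_right hle ?_)
      rw [Submodule.disjoint_def]
      intro z hz hz'
      obtain ⟨c, rfl⟩ := (Finsupp.mem_span_range_iff_exists_finsupp).1 hz
      exact Finset.sum_eq_zero fun j hj => by
        simp [D.eq_zero_of_sum_mem_borel c.support c hz' j hj])
    (by
      rw [← D.span_f_sup_borel, Set.Sum.elim_range, Submodule.span_union]
      refine sup_le_sup_left (fun z hz => ?_) _
      have h : (⟨z, hz⟩ : borel Δ) ∈ Submodule.span ℂ (Set.range (borelBasis Δ)) :=
        (borelBasis Δ).span_eq ▸ Submodule.mem_top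
      have := Submodule.mem_map_of_mem (f := (borel Δ).toSubmodule.subtype) h
      rwa [Submodule.map_span, ← Set.range_comp] at this)

theorem RootVectors.basis_inl (j : J) : D.basis (Sum.inl j) = D.f j := by
  simp [RootVectors.basis]

theorem RootVectors.basis_inr (k : BorelIndex Δ) : D.basis (Sum.inr k) = borelBasis Δ k := by
  simp [RootVectors.basis]

/-- The factors of a Poincaré–Birkhoff–Witt monomial, with the negative root vectors first. -/
def pbwList (a : Multiset J × Multiset (BorelIndex Δ)) : List (J ⊕ BorelIndex Δ) :=
  a.1.toList.map Sum.inl ++ a.2.toList.map Sum.inr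

theorem coe_pbwList (a : Multiset J × Multiset (BorelIndex Δ)) :
    (pbwList a : Multiset (J ⊕ BorelIndex Δ)) = a.1.map Sum.inl + a.2.map Sum.inr := by
  rw [pbwList, ← Multiset.coe_add, ← Multiset.map_coe, ← Multiset.map_coe, Multiset.coe_toList,
    Multiset.coe_toList]

theorem pbwList_injective : Function.Injective fun a : Multiset J × Multiset (BorelIndex Δ) =>
    (pbwList a : Multiset (J ⊕ BorelIndex Δ)) := by
  classical
  intro a a' h
  simp only [coe_pbwList] at h
  refine Prod.ext (Multiset.ext.2 fun j => ?_) (Multiset.ext.2 fun k => ?_)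
  · have := congrArg (Multiset.count (Sum.inl j)) h
    simpa [Multiset.count_map_eq_count' _ _ Sum.inl_injective, Multiset.count_eq_zero_of_notMem]
      using this
  · have := congrArg (Multiset.count (Sum.inr k)) h
    simpa [Multiset.count_map_eq_count' _ _ Sum.inr_injective, Multiset.count_eq_zero_of_notMem]
      using this

theorem exists_perm_pbwList (l : List (J ⊕ BorelIndex Δ)) :
    ∃ a : Multiset J × Multiset (BorelIndex Δ), l.Perm (pbwList a) := by
  suffices h : ∀ s : Multiset (J ⊕ BorelIndex Δ),
      ∃ a : Multiset J × Multiset (BorelIndex Δ), s = a.1.map Sum.inl + a.2.map Sum.inr by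
    obtain ⟨a, ha⟩ := h l
    exact ⟨a, Multiset.coe_eq_coe.1 (by rw [ha, coe_pbwList])⟩
  intro s
  induction s using Multiset.induction_on with
  | empty => exact ⟨(0, 0), by simp⟩
  | cons i s ih =>
    obtain ⟨a, rfl⟩ := ih
    rcases i with j | k
    · exact ⟨(j ::ₘ a.1, a.2), by simp⟩
    · exact ⟨(a.1, k ::ₘ a.2), by simp⟩

theorem center_eq_zero (z : 𝔤) (hz : ∀ y : 𝔤, ⁅z, y⁆ = 0) : z = 0 := by
  have h : z ∈ LieAlgebra.center ℂ 𝔤 := by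
    rw [LieModule.mem_maxTrivSubmodule]
    intro y
    rw [← lie_skew, hz, neg_zero]
  rw [LieAlgebra.center_eq_bot] at h
  simpa using h

/-- The Poincaré–Birkhoff–Witt basis of `U(𝔤)`. -/
def RootVectors.pbwBasis : Module.Basis (Multiset J × Multiset (BorelIndex Δ)) ℂ (U 𝔤) :=
  Module.Basis.mk
    (UniversalEnvelopingAlgebra.linearIndependent_prod_map center_eq_zero D.basis
      (r := pbwList) pbwList_injective)
    (UniversalEnvelopingAlgebra.span_prod_map_eq_top D.basis.span_eq exists_perm_pbwList).ge

/-- The inclusion of `U(𝔟)` in `U(𝔤)`. -/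
def borelIncl (Δ : RootPairing.Base (rootSystem 𝔥)) : U (borel Δ) →ₐ[ℂ] U 𝔤 :=
  let := LieRing.ofAssociativeRing (A := U 𝔤)
  UniversalEnvelopingAlgebra.lift ℂ
    ((UniversalEnvelopingAlgebra.ι ℂ : 𝔤 →ₗ⁅ℂ⁆ U 𝔤).comp (borel Δ).incl)

theorem borelIncl_ι (z : borel Δ) : borelIncl Δ (UniversalEnvelopingAlgebra.ι ℂ z) =
    UniversalEnvelopingAlgebra.ι ℂ (z : 𝔤) := by
  rw [borelIncl, UniversalEnvelopingAlgebra.lift_ι_apply]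
  rfl

/-- The character of `U(𝔟)` with which it acts on `ℂ_lam`. -/
def borelChar (Δ : RootPairing.Base (rootSystem 𝔥)) (lam : Module.Dual ℂ 𝔥) :
    U (borel Δ) →ₐ[ℂ] ℂ :=
  let := LieRing.ofAssociativeRing (A := ℂ)
  UniversalEnvelopingAlgebra.lift ℂ
    { extend lam ∘ₗ (borel Δ).toSubmodule.subtype with
      map_lie' := fun {x y} => by
        rw [LieRing.of_associative_ring_bracket, mul_comm, sub_self]
        exact extend_lie_borel Δ lam x.2 y.2 }

theorem borelChar_ι (z : borel Δ) :
    borelChar Δ lam (UniversalEnvelopingAlgebra.ι ℂ z) = extend lam (z : 𝔤) := by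
  rw [borelChar, UniversalEnvelopingAlgebra.lift_ι_apply]
  rfl

/-- A monomial in the basis of the Borel subalgebra. -/
def borelMonomial (Δ : RootPairing.Base (rootSystem 𝔥)) (c : Multiset (BorelIndex Δ)) :
    U (borel Δ) :=
  (c.toList.map fun k => UniversalEnvelopingAlgebra.ι ℂ (borelBasis Δ k)).prod

theorem span_borelMonomial (Δ : RootPairing.Base (rootSystem 𝔥)) :
    Submodule.span ℂ (Set.range (borelMonomial Δ)) = ⊤ :=
  UniversalEnvelopingAlgebra.span_prod_map_eq_top (borelBasis Δ).span_eq fun l =>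
    ⟨l, Multiset.coe_eq_coe.1 (Multiset.coe_toList _).symm⟩

theorem RootVectors.pbwBasis_apply (a : Multiset J × Multiset (BorelIndex Δ)) :
    D.pbwBasis a = word D.f a.1.toList * borelIncl Δ (borelMonomial Δ a.2) := by
  rw [RootVectors.pbwBasis, Module.Basis.mk_apply, pbwList, List.map_append, List.prod_append,
    borelMonomial, map_list_prod, List.map_map, List.map_map, List.map_map, word]
  simp only [Function.comp_def, D.basis_inl, D.basis_inr, borelIncl_ι]

/-- The projection of `U(𝔤) = U(𝔫₋) ⊗ U(𝔟)` to `U(𝔫₋)` by means of the character of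
`U(𝔟)`. -/
def RootVectors.vermaCoordAux (lam : Module.Dual ℂ 𝔥) : U 𝔤 →ₗ[ℂ] (Multiset J →₀ ℂ) :=
  D.pbwBasis.constr ℂ fun a => Finsupp.single a.1 (borelChar Δ lam (borelMonomial Δ a.2))

/-- Both sides are linear in z, so the defining case of basis monomials suffices. With arbitrary z
allowed, a further right factor from 𝔟 is absorbed without reordering. -/
theorem RootVectors.vermaCoordAux_mul (a : Multiset J) (z : U (borel Δ)) :
    D.vermaCoordAux lam (word D.f a.toList * borelIncl Δ z) =
      Finsupp.single a (borelChar Δ lam z) := by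
  have hz : z ∈ Submodule.span ℂ (Set.range (borelMonomial Δ)) :=
    span_borelMonomial Δ ▸ Submodule.mem_top
  induction hz using Submodule.span_induction with
  | mem z hz =>
    obtain ⟨c, rfl⟩ := hz
    rw [← D.pbwBasis_apply (a, c), RootVectors.vermaCoordAux, Module.Basis.constr_basis]
  | zero => simp
  | add p q _ _ hp hq => rw [map_add, mul_add, map_add, hp, hq, map_add, Finsupp.single_add]
  | smul t p _ hp => rw [map_smul, mul_smul_comm, map_smul, hp, map_smul, Finsupp.smul_single]

/-- This is the balancing relation, which lets the projection descend to M_λ. -/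
theorem RootVectors.vermaCoordAux_mul_ι (u : U 𝔤) (z : borel Δ) :
    D.vermaCoordAux lam (u * UniversalEnvelopingAlgebra.ι ℂ (z : 𝔤)) =
      extend lam (z : 𝔤) • D.vermaCoordAux lam u := by
  have hu : u ∈ Submodule.span ℂ (Set.range D.pbwBasis) := D.pbwBasis.span_eq ▸ Submodule.mem_top
  induction hu using Submodule.span_induction with
  | mem u hu =>
    obtain ⟨a, rfl⟩ := hu
    rw [D.pbwBasis_apply, mul_assoc, ← borelIncl_ι, ← map_mul, D.vermaCoordAux_mul,
      D.vermaCoordAux_mul, map_mul, borelChar_ι, Finsupp.smul_single, smul_eq_mul, mul_comm]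
  | zero => simp
  | add p q _ _ hp hq => rw [add_mul, map_add, hp, hq, map_add, smul_add]
  | smul t p _ hp => rw [smul_mul_assoc, map_smul, hp, map_smul, smul_comm]

/-- The monomials in the negative root vectors, applied to the highest weight vector. -/
def RootVectors.vermaVector (lam : Module.Dual ℂ 𝔥) (a : Multiset J) : VermaModule Δ lam :=
  envAct ℂ 𝔤 _ (word D.f a.toList) (highestWeightVector Δ lam)

/-- These coordinates give independence of the monomials f^a x_λ and, through the coefficient of the
empty monomial, the form x_μ^*. -/
theorem RootVectors.exists_vermaCoord (lam : Module.Dual ℂ 𝔥) :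
    ∃ ψ : VermaModule Δ lam →ₗ[ℂ] (Multiset J →₀ ℂ),
      ∀ a, ψ (D.vermaVector lam a) = Finsupp.single a 1 := by
  let s : OneDim Δ lam →ₗ[ℂ] ℂ := LinearMap.id (M := ℂ)
  have hs : ∀ w : OneDim Δ lam, s w = (show ℂ from w) := fun _ => rfl
  obtain ⟨ψ, hψ⟩ := Ind.exists_lift (𝔨 := borel Δ) (W := OneDim Δ lam)
    (TensorProduct.lift ((LinearMap.lsmul ℂ (Multiset J →₀ ℂ)).compl₁₂ s
      (D.vermaCoordAux lam)).flip) (fun u z w => by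
        rw [TensorProduct.lift.tmul, TensorProduct.lift.tmul]
        simp only [LinearMap.flip_apply, LinearMap.compl₁₂_apply, LinearMap.lsmul_apply]
        rw [D.vermaCoordAux_mul_ι, OneDim.lie_def, map_smul, smul_comm, smul_assoc])
  refine ⟨ψ, fun a => ?_⟩
  have h := D.vermaCoordAux_mul (lam := lam) a 1
  rw [map_one, map_one, mul_one] at h
  rw [RootVectors.vermaVector, Ind.envAct_apply, highestWeightVector, Ind.smul_tmul, mul_one, hψ,
    TensorProduct.lift.tmul]
  simp only [LinearMap.flip_apply, LinearMap.compl₁₂_apply, LinearMap.lsmul_apply]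
  rw [h]
  exact one_smul ℂ _

theorem RootVectors.linearIndependent_vermaVector : LinearIndependent ℂ (D.vermaVector lam) := by
  obtain ⟨ψ, hψ⟩ := D.exists_vermaCoord lam
  refine LinearIndependent.of_comp ψ ?_
  have : ψ ∘ D.vermaVector lam = fun a => Finsupp.single a 1 := funext hψ
  rw [this]
  exact Finsupp.linearIndependent_single_one ℂ _

theorem envAct_borelIncl_highestWeightVector (z : U (borel Δ)) :
    envAct ℂ 𝔤 _ (borelIncl Δ z) (highestWeightVector Δ lam) =
      borelChar Δ lam z • highestWeightVector Δ lam := by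
  have hz : z ∈ Algebra.adjoin ℂ (Set.range (UniversalEnvelopingAlgebra.ι ℂ : borel Δ → _)) := by
    rw [UniversalEnvelopingAlgebra.adjoin_range_ι]; exact Algebra.mem_top
  induction hz using Algebra.adjoin_induction with
  | mem z hz =>
    obtain ⟨z, rfl⟩ := hz
    rw [borelIncl_ι, envAct_ι, borelChar_ι, lie_highestWeightVector z.2]
  | algebraMap t => simp
  | add p q _ _ hp hq => rw [map_add, map_add, LinearMap.add_apply, hp, hq, map_add, add_smul]
  | mul p q _ _ hp hq =>
    rw [map_mul, map_mul, Module.End.mul_apply, hq, map_smul, hp, smul_smul, map_mul, mul_comm]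

theorem RootVectors.span_vermaVector :
    Submodule.span ℂ (Set.range (D.vermaVector lam)) = ⊤ := by
  refine Submodule.eq_top_iff'.2 fun m => ?_
  obtain ⟨u, rfl⟩ := exists_envAct_highestWeightVector m
  have hu : u ∈ Submodule.span ℂ (Set.range D.pbwBasis) := D.pbwBasis.span_eq ▸ Submodule.mem_top
  induction hu using Submodule.span_induction with
  | mem u hu =>
    obtain ⟨a, rfl⟩ := hu
    rw [D.pbwBasis_apply, map_mul, Module.End.mul_apply, envAct_borelIncl_highestWeightVector,
      map_smul]
    exact Submodule.smul_mem _ _ (Submodule.subset_span ⟨a.1, rfl⟩)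
  | zero => simp
  | add p q _ _ hp hq => rw [map_add, LinearMap.add_apply]; exact add_mem hp hq
  | smul t p _ hp => rw [map_smul, LinearMap.smul_apply]; exact Submodule.smul_mem _ _ hp

end Basis

end Verma

end

/-! ### Contraction with linear forms -/

noncomputable section

namespace Verma

open LieAlgebra LieAlgebra.IsKilling

local notation "U" => UniversalEnvelopingAlgebra ℂ

section Contract

variable {L M V : Type*} [LieRing L] [LieAlgebra ℂ L]
  [AddCommGroup M] [Module ℂ M] [LieRingModule L M] [LieModule ℂ L M]
  [AddCommGroup V] [Module ℂ V] [LieRingModule L V] [LieModule ℂ L V]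

theorem contract_tmul (p : Module.Dual ℂ M) (m : M) (v : V) :
    contract p (m ⊗ₜ[ℂ] v) = p m • v := by
  simp [contract]

theorem contract_add (p q : Module.Dual ℂ M) (w : M ⊗[ℂ] V) :
    contract (p + q) w = contract p w + contract q w := by
  simp [contract, LinearMap.rTensor_add]

theorem contract_smul (c : ℂ) (p : Module.Dual ℂ M) (w : M ⊗[ℂ] V) :
    contract (c • p) w = c • contract p w := by
  simp [contract, LinearMap.rTensor_smul]

theorem contract_lie (p : Module.Dual ℂ M) (z : L) (w : M ⊗[ℂ] V) :
    contract p ⁅z, w⁆ = ⁅z, contract p w⁆ - contract ⁅z, p⁆ w := by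
  induction w with
  | zero => simp
  | tmul m v =>
    rw [TensorProduct.LieModule.lie_tmul_right, map_add, contract_tmul, contract_tmul,
      contract_tmul, contract_tmul, Module.Dual.lie_apply, lie_smul, neg_smul]
    abel
  | add a b ha hb => rw [lie_add, map_add, ha, hb, map_add, map_add, lie_add]; abel

theorem dual_apply_eq_zero {h : L} {p : Module.Dual ℂ M} {m : M} {c d : ℂ}
    (hp : ⁅h, p⁆ = c • p) (hm : ⁅h, m⁆ = d • m) (hcd : c + d ≠ 0) : p m = 0 := by
  have h1 := LinearMap.congr_fun hp m
  rw [Module.Dual.lie_apply, hm, map_smul, LinearMap.smul_apply, smul_eq_mul, smul_eq_mul] at h1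
  refine (mul_eq_zero.1 (?_ : (c + d) * p m = 0)).resolve_left hcd
  linear_combination -h1

/-- A family of linear forms separating the points of `M` separates, by contraction, the points
of `M ⊗ V`. -/
theorem eq_zero_of_contract_eq_zero [FiniteDimensional ℂ V] {κ : Type*} {p : κ → Module.Dual ℂ M}
    (hp : ∀ m, (∀ k, p k m = 0) → m = 0) {w : M ⊗[ℂ] V} (hw : ∀ k, contract (p k) w = 0) :
    w = 0 := by
  let B := Module.finBasis ℂ V
  obtain ⟨b, rfl⟩ := TensorProduct.eq_repr_basis_right B w
  suffices h : b = 0 by rw [h, Finsupp.sum_zero_index]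
  ext i
  refine hp _ fun k => ?_
  have h := hw k
  rw [Finsupp.sum_fintype _ _ (by simp), map_sum] at h
  simp only [contract_tmul] at h
  exact Fintype.linearIndependent_iff.1 B.linearIndependent _ h i

end Contract

/-! ### The lowest weight form and the forms it generates -/

variable {𝔤 : Type*} [LieRing 𝔤] [LieAlgebra ℂ 𝔤] [FiniteDimensional ℂ 𝔤] [IsKilling ℂ 𝔤]
  {𝔥 : LieSubalgebra ℂ 𝔤} [𝔥.IsCartanSubalgebra]
  {Δ : RootPairing.Base (rootSystem 𝔥)} {lam mu : Module.Dual ℂ 𝔥}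
  {J : Type*} (D : RootVectors Δ J)

theorem lie_cartan_highestWeightVector (h : 𝔥) :
    ⁅(h : 𝔤), highestWeightVector Δ lam⁆ = lam h • highestWeightVector Δ lam := by
  rw [lie_highestWeightVector (cartan_le_borel Δ h.2), extend_cartan]

/-- The sum of the heights of the roots in a list. -/
def RootVectors.listHt (l : List J) : ℕ := (l.map D.ht).sum

theorem RootVectors.listHt_eq_zero {l : List J} (hl : D.listHt l = 0) : l = [] := by
  cases l with
  | nil => rfl
  | cons j l => simp [RootVectors.listHt, D.ht_ne_zero] at hl

theorem RootVectors.sum_map_root_level (l : List J) :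
    (l.map fun j => D.root j D.level).sum = D.listHt l := by
  simp only [D.root_level, RootVectors.listHt]
  induction l with
  | nil => simp
  | cons j l ih => simp [ih]

theorem RootVectors.lie_level_word_f (l : List J) :
    ⁅(D.level : 𝔤), envAct ℂ 𝔤 _ (word D.f l) (highestWeightVector Δ lam)⁆ =
      (lam D.level - D.listHt l) • envAct ℂ 𝔤 _ (word D.f l) (highestWeightVector Δ lam) := by
  have h : (l.map fun j => (-D.root j) D.level).sum = -D.listHt l := by
    rw [← D.sum_map_root_level]
    simp only [LinearMap.neg_apply]
    induction l with
    | nil => simp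
    | cons j l ih => simp [ih, add_comm]
  rw [lie_envAct_word D.f (fun j => D.lie_f D.level j) (lie_cartan_highestWeightVector D.level), h,
    sub_eq_add_neg]

theorem RootVectors.lie_level_word_e {N : Type*} [AddCommGroup N] [Module ℂ N]
    [LieRingModule 𝔤 N] [LieModule ℂ 𝔤 N] {c : ℂ} {n : N} (hn : ⁅(D.level : 𝔤), n⁆ = c • n)
    (l : List J) :
    ⁅(D.level : 𝔤), envAct ℂ 𝔤 N (word D.e l) n⁆ =
      (c + D.listHt l) • envAct ℂ 𝔤 N (word D.e l) n := by
  rw [lie_envAct_word D.e (fun j => D.lie_e D.level j) hn, D.sum_map_root_level]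

variable {xi : Module.Dual ℂ (VermaModule Δ mu)}

theorem IsLowestWeightDual.lie_cartan (hxi : IsLowestWeightDual Δ mu xi) (h : 𝔥) :
    ⁅(h : 𝔤), xi⁆ = (-mu h) • xi :=
  (LieModule.mem_weightSpace _ _).1 hxi.mem_weightSpace h

/-- A form of weight -μ pairs to zero with vectors of any weight other than μ, and a nonempty word
in the f has positive height. -/
theorem IsLowestWeightDual.apply_word_f (hxi : IsLowestWeightDual Δ mu xi) {l : List J}
    (hl : l ≠ []) : xi (envAct ℂ 𝔤 _ (word D.f l) (highestWeightVector Δ mu)) = 0 := by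
  refine dual_apply_eq_zero (hxi.lie_cartan D.level) (D.lie_level_word_f l) fun h => hl ?_
  refine D.listHt_eq_zero ?_
  have : (D.listHt l : ℂ) = 0 := by linear_combination -h
  exact_mod_cast this

theorem dual_ext {p q : Module.Dual ℂ (VermaModule Δ mu)}
    (h : ∀ a, p (D.vermaVector mu a) = q (D.vermaVector mu a)) : p = q :=
  LinearMap.ext_on_range D.span_vermaVector h

theorem IsLowestWeightDual.apply_vermaVector [DecidableEq J] (hxi : IsLowestWeightDual Δ mu xi)
    (a : Multiset J) :
    xi (D.vermaVector mu a) = if a = 0 then 1 else 0 := by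
  split_ifs with ha
  · rw [ha, RootVectors.vermaVector, Multiset.toList_zero, envAct_word_nil,
      hxi.apply_highestWeightVector]
  · exact hxi.apply_word_f D (by simpa using ha)

include D in
theorem existsUnique_isLowestWeightDual :
    ∃! xi : Module.Dual ℂ (VermaModule Δ mu), IsLowestWeightDual Δ mu xi := by
  classical
  obtain ⟨ψ, hψ⟩ := D.exists_vermaCoord mu
  let xi : Module.Dual ℂ (VermaModule Δ mu) := Finsupp.lapply 0 ∘ₗ ψ
  have hxi : ∀ a, xi (D.vermaVector mu a) = if a = 0 then 1 else 0 := fun a => by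
    simp [xi, hψ, Finsupp.single_apply]
  refine ⟨xi, ⟨(LieModule.mem_weightSpace _ _).2 fun h => dual_ext D fun a => ?_, ?_⟩,
    fun xi' hxi' => dual_ext D fun a => by rw [hxi, hxi'.apply_vermaVector D]⟩
  · change -xi ⁅(h : 𝔤), D.vermaVector mu a⁆ = (-mu h) • xi (D.vermaVector mu a)
    rw [RootVectors.vermaVector, lie_envAct_word D.f (fun j => D.lie_f h j)
      (lie_cartan_highestWeightVector h), ← RootVectors.vermaVector, map_smul, hxi]
    split_ifs with ha
    · simp [ha]
    · simp
  · have := hxi 0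
    rwa [RootVectors.vermaVector, Multiset.toList_zero, envAct_word_nil, if_pos rfl] at this

/-- Up to sign, the pairing with m is that of x_μ^* with f_j m, which for a monomial vector m comes
from a nonempty word. -/
theorem IsLowestWeightDual.lie_f (hxi : IsLowestWeightDual Δ mu xi) (j : J) : ⁅D.f j, xi⁆ = 0 := by
  refine dual_ext D fun a => ?_
  rw [Module.Dual.lie_apply, RootVectors.vermaVector, ← envAct_word_cons,
    hxi.apply_word_f D (by simp), neg_zero, LinearMap.zero_apply]

/-- The linear form `e_{j₁} ⋯ e_{jₖ} x_mu^*`. -/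
def RootVectors.dualVector (xi : Module.Dual ℂ (VermaModule Δ mu)) (l : List J) :
    Module.Dual ℂ (VermaModule Δ mu) :=
  envAct ℂ 𝔤 (Module.Dual ℂ (VermaModule Δ mu)) (word D.e l) xi

theorem RootVectors.lie_e_dualVector (j : J) (l : List J) :
    ⁅D.e j, D.dualVector xi l⁆ = D.dualVector xi (j :: l) :=
  (envAct_word_cons D.e j l xi).symm

/-- The triangular decomposition puts z x_μ^* in the span for every z. Longer words follow from z
e_j p = [z, e_j] p + e_j z p, by an induction on length that keeps z arbitrary. -/
theorem lie_mem_span_dualVector (hxi : IsLowestWeightDual Δ mu xi) (z : 𝔤)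
    {p : Module.Dual ℂ (VermaModule Δ mu)}
    (hp : p ∈ Submodule.span ℂ (Set.range (D.dualVector xi))) :
    ⁅z, p⁆ ∈ Submodule.span ℂ (Set.range (D.dualVector xi)) := by
  set S := Submodule.span ℂ (Set.range (D.dualVector xi))
  have he : ∀ j, ∀ q ∈ S, ⁅D.e j, q⁆ ∈ S := fun j q hq => by
    induction hq using Submodule.span_induction with
    | mem q hq =>
      obtain ⟨l, rfl⟩ := hq
      rw [D.lie_e_dualVector]
      exact Submodule.subset_span ⟨_, rfl⟩
    | zero => simp
    | add a b _ _ ha hb => rw [lie_add]; exact add_mem ha hb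
    | smul c a _ ha => rw [lie_smul]; exact Submodule.smul_mem _ _ ha
  have hx : xi ∈ S := Submodule.subset_span ⟨[], envAct_word_nil D.e xi⟩
  let T : Submodule ℂ 𝔤 := S.comap
    ({ toFun := fun z => ⁅z, xi⁆
       map_add' := fun y z => add_lie y z xi
       map_smul' := fun c z => smul_lie c z xi } :
      𝔤 →ₗ[ℂ] Module.Dual ℂ (VermaModule Δ mu))
  have hT : ∀ z : 𝔤, z ∈ T ↔ ⁅z, xi⁆ ∈ S := fun z => Iff.rfl
  have hTtop : T = ⊤ := by
    refine eq_top_iff.2 (D.span_f_sup_borel.ge.trans (sup_le (Submodule.span_le.2 ?_)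
      (sup_le (fun h hh => ?_) ?_)))
    · rintro _ ⟨j, rfl⟩
      exact (hT _).2 ((hxi.lie_f D j).symm ▸ zero_mem _)
    · refine (hT _).2 ?_
      have h1 := hxi.lie_cartan ⟨h, hh⟩
      simp only at h1
      rw [h1]
      exact Submodule.smul_mem _ _ hx
    · rw [← D.span_e]
      refine Submodule.span_le.2 ?_
      rintro _ ⟨j, rfl⟩
      exact (hT _).2 (he j _ hx)
  have hl : ∀ (l : List J) (z : 𝔤), ⁅z, D.dualVector xi l⁆ ∈ S := by
    intro l
    induction l with
    | nil =>
      intro z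
      rw [RootVectors.dualVector, envAct_word_nil]
      exact (hT z).1 (hTtop ▸ Submodule.mem_top)
    | cons j l ih =>
      intro z
      rw [← D.lie_e_dualVector, leibniz_lie]
      exact add_mem (ih _) (he j _ (ih z))
  induction hp using Submodule.span_induction with
  | mem q hq => obtain ⟨l, rfl⟩ := hq; exact hl l z
  | zero => simp
  | add a b _ _ ha hb => rw [lie_add]; exact add_mem ha hb
  | smul c a _ ha => rw [lie_smul]; exact Submodule.smul_mem _ _ ha

/-- If `M_mu` is irreducible, then the linear forms in `U(𝔫₊) x_mu^*` separate its points. -/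
theorem eq_zero_of_dualVector_eq_zero (hxi : IsLowestWeightDual Δ mu xi)
    (hmu : LieModule.IsIrreducible ℂ 𝔤 (VermaModule Δ mu)) {m : VermaModule Δ mu}
    (hm : ∀ l, D.dualVector xi l m = 0) : m = 0 := by
  let S := Submodule.span ℂ (Set.range (D.dualVector xi))
  let A : LieSubmodule ℂ 𝔤 (VermaModule Δ mu) :=
    { S.dualCoannihilator with
      lie_mem := fun {z m} hm => by
        refine (Submodule.mem_dualCoannihilator _).2 fun p hp => ?_
        have h := (Submodule.mem_dualCoannihilator _).1 hm _ (lie_mem_span_dualVector D hxi z hp)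
        rwa [Module.Dual.lie_apply, neg_eq_zero] at h }
  have hA : ∀ m, m ∈ A ↔ ∀ p ∈ S, p m = 0 := fun m => Submodule.mem_dualCoannihilator _
  have hmA : m ∈ A := (hA m).2 fun p hp => by
    induction hp using Submodule.span_induction with
    | mem q hq => obtain ⟨l, rfl⟩ := hq; exact hm l
    | zero => simp
    | add a b _ _ ha hb => simp [ha, hb]
    | smul c a _ ha => simp [ha]
  rcases eq_bot_or_eq_top A with h | h
  · rw [h] at hmA
    simpa using hmA
  · have h1 : highestWeightVector Δ mu ∈ A := h ▸ LieSubmodule.mem_top _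
    have h2 := (hA _).1 h1 _ (Submodule.subset_span ⟨[], envAct_word_nil D.e xi⟩)
    rw [hxi.apply_highestWeightVector] at h2
    exact absurd h2 one_ne_zero

/-- Since 𝔫₊ is closed under brackets, straightening applies to the e alone, inside U(𝔤). -/
theorem RootVectors.word_e_mem_span (l : List J) :
    (word D.e l : U 𝔤) ∈ Submodule.span ℂ (Set.range fun b : Multiset J => word D.e b.toList) := by
  refine prod_map_mem_span_of_commutator_mem
    (x := fun j => UniversalEnvelopingAlgebra.ι ℂ (D.e j)) (r := Multiset.toList)
    (fun i j => ?_) (fun l =>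
    ⟨l, Multiset.coe_eq_coe.1 (Multiset.coe_toList _).symm⟩) l
  have hmem : ∀ k, D.e k ∈ nPos Δ := fun k => D.span_e ▸ Submodule.subset_span ⟨k, rfl⟩
  have h := lie_nPos_nPos Δ (hmem i) (hmem j)
  rw [← D.span_e] at h
  rw [← UniversalEnvelopingAlgebra.ι_lie]
  exact UniversalEnvelopingAlgebra.ι_mem_span h

theorem eq_zero_of_dualVector_toList_eq_zero (hxi : IsLowestWeightDual Δ mu xi)
    (hmu : LieModule.IsIrreducible ℂ 𝔤 (VermaModule Δ mu)) {m : VermaModule Δ mu}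
    (hm : ∀ b : Multiset J, D.dualVector xi b.toList m = 0) : m = 0 := by
  refine eq_zero_of_dualVector_eq_zero D hxi hmu fun l => ?_
  rw [RootVectors.dualVector]
  have hl := D.word_e_mem_span l
  generalize (word D.e l : U 𝔤) = u at hl ⊢
  induction hl using Submodule.span_induction with
  | mem u hu => obtain ⟨b, rfl⟩ := hu; exact hm b
  | zero => simp
  | add p q _ _ hp hq => rw [map_add, LinearMap.add_apply, LinearMap.add_apply, hp, hq, add_zero]
  | smul t p _ hp => rw [map_smul, LinearMap.smul_apply, LinearMap.smul_apply, hp, smul_zero]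

theorem dualVector_apply_vermaVector_eq_zero (hxi : IsLowestWeightDual Δ mu xi) {l : List J}
    {a : Multiset J} (h : D.listHt l ≠ D.listHt a.toList) :
    D.dualVector xi l (D.vermaVector mu a) = 0 := by
  refine dual_apply_eq_zero (D.lie_level_word_e (hxi.lie_cartan D.level) l)
    (D.lie_level_word_f a.toList) fun h0 => h ?_
  have : (D.listHt l : ℂ) = D.listHt a.toList := by linear_combination h0
  exact_mod_cast this

/-- Every height is at least 1, so a multiset of total height n has at most n elements. -/
theorem RootVectors.finite_listHt_eq [Finite J] (n : ℕ) :
    {a : Multiset J | D.listHt a.toList = n}.Finite := by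
  classical
  have := Fintype.ofFinite J
  refine (Set.finite_Iic (n • (Finset.univ : Finset J).val)).subset fun a ha => ?_
  refine Multiset.le_iff_count.2 fun j => ?_
  rw [Multiset.count_nsmul, Multiset.count_univ, mul_one]
  refine (Multiset.count_le_card j a).trans ?_
  have ha' : D.listHt a.toList = n := ha
  rw [← Multiset.length_toList, ← ha', RootVectors.listHt,
    ← List.length_map (as := a.toList) D.ht]
  refine List.length_le_sum_of_one_le _ fun k hk => ?_
  obtain ⟨i, -, rfl⟩ := List.mem_map.1 hk
  exact Nat.one_le_iff_ne_zero.2 (D.ht_ne_zero i)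

/-- For monomials of the height of `a`, the pairing is a square matrix. A combination of the f^b x_μ
in its kernel also pairs to zero with the other heights, by weights, hence vanishes by
irreducibility; independence makes its coefficients zero. So the matrix is invertible. -/
theorem exists_dual_vector [Finite J] (hxi : IsLowestWeightDual Δ mu xi)
    (hmu : LieModule.IsIrreducible ℂ 𝔤 (VermaModule Δ mu)) [DecidableEq J] (a : Multiset J) :
    ∃ m : VermaModule Δ mu, ∀ b : Multiset J,
      D.dualVector xi b.toList m = if a = b then 1 else 0 := by
  let A := {b : Multiset J | D.listHt b.toList = D.listHt a.toList}
  have : Fintype A := (D.finite_listHt_eq _).fintype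
  let T : (A → ℂ) →ₗ[ℂ] VermaModule Δ mu := Fintype.linearCombination ℂ fun b : A => D.vermaVector mu b
  have hT : ∀ c, T c = ∑ b : A, c b • D.vermaVector mu b := fun c => rfl
  let F : (A → ℂ) →ₗ[ℂ] (A → ℂ) := LinearMap.pi fun b : A => D.dualVector xi b.1.toList ∘ₗ T
  have hzero : ∀ c (l : List J), D.listHt l ≠ D.listHt a.toList → D.dualVector xi l (T c) = 0 := by
    intro c l hl
    rw [hT, map_sum]
    refine Finset.sum_eq_zero fun b _ => ?_
    rw [map_smul, dualVector_apply_vermaVector_eq_zero D hxi (fun h => hl (h.trans b.2)), smul_zero]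
  have hF : Function.Injective F := by
    refine (injective_iff_map_eq_zero F).2 fun c hc => ?_
    have hTc : T c = 0 := by
      refine eq_zero_of_dualVector_toList_eq_zero D hxi hmu fun b => ?_
      by_cases hb : D.listHt b.toList = D.listHt a.toList
      · exact congrFun hc ⟨b, hb⟩
      · exact hzero c _ hb
    exact funext (Fintype.linearIndependent_iff.1
      ((D.linearIndependent_vermaVector (lam := mu)).comp _ Subtype.val_injective) c hTc)
  obtain ⟨c, hc⟩ := (LinearMap.injective_iff_surjective.1 hF) (Pi.single ⟨a, rfl⟩ 1)
  refine ⟨T c, fun b => ?_⟩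
  by_cases hb : D.listHt b.toList = D.listHt a.toList
  · have h := congrFun hc ⟨b, hb⟩
    change D.dualVector xi b.toList (T c) = _ at h
    rw [h, Pi.single_apply]
    simp only [Subtype.mk.injEq, eq_comm]
  · rw [hzero c _ hb, if_neg]
    rintro rfl
    exact hb rfl

/-! ### Singular vectors and intertwiners -/

section Intertwiners

variable {V : Type*} [AddCommGroup V] [Module ℂ V]
  [LieRingModule 𝔤 V] [LieModule ℂ 𝔤 V]

/-- A nonzero e^a v is an eigenvector of `D.level` with eigenvalue c plus the height of a. V has
finitely many eigenvalues, and each height has finitely many a. -/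
theorem finite_word_e_ne_zero [Finite J] [FiniteDimensional ℂ V]
    {c : ℂ} {v : V} (hv : ⁅(D.level : 𝔤), v⁆ = c • v) :
    {a : Multiset J | envAct ℂ 𝔤 V (word D.e a.toList) v ≠ 0}.Finite := by
  have hfin : {n : ℕ | (LieModule.toEnd ℂ 𝔤 V D.level).HasEigenvalue (c + n)}.Finite :=
    (Module.End.finite_hasEigenvalue (LieModule.toEnd ℂ 𝔤 V D.level)).preimage
      (fun m _ n _ h => by simpa using h)
  refine (hfin.biUnion fun n _ => D.finite_listHt_eq n).subset fun a ha => ?_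
  refine Set.mem_biUnion (x := D.listHt a.toList) ?_ rfl
  exact Module.End.hasEigenvalue_of_hasEigenvector
    ⟨Module.End.mem_eigenspace_iff.2 (D.lie_level_word_e hv a.toList), ha⟩

theorem exists_contract_dualVector_eq [Finite J] [FiniteDimensional ℂ V]
    (hxi : IsLowestWeightDual Δ mu xi)
    (hmu : LieModule.IsIrreducible ℂ 𝔤 (VermaModule Δ mu)) {c : ℂ} {v : V}
    (hv : ⁅(D.level : 𝔤), v⁆ = c • v) :
    ∃ w : VermaModule Δ mu ⊗[ℂ] V, ∀ l,
      contract (D.dualVector xi l) w = envAct ℂ 𝔤 V (word D.e l) v := by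
  classical
  choose m hm using exists_dual_vector D hxi hmu
  have hfin := finite_word_e_ne_zero D hv
  refine ⟨∑ a ∈ hfin.toFinset, m a ⊗ₜ envAct ℂ 𝔤 V (word D.e a.toList) v, fun l => ?_⟩
  set w := ∑ a ∈ hfin.toFinset, m a ⊗ₜ[ℂ] envAct ℂ 𝔤 V (word D.e a.toList) v with hw
  have hmul : ∀ b : Multiset J, contract (D.dualVector xi b.toList) w =
      envAct ℂ 𝔤 V (word D.e b.toList) v := fun b => by
    rw [hw, map_sum]
    simp only [contract_tmul, hm, ite_smul, one_smul, zero_smul, Finset.sum_ite_eq']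
    split_ifs with hb
    · rfl
    · exact (not_not.1 fun h => hb (hfin.mem_toFinset.2 h)).symm
  -- Both sides are linear in the element of U(𝔤) applied, so ordered monomials determine all words.
  rw [RootVectors.dualVector]
  have hl := D.word_e_mem_span l
  generalize (word D.e l : U 𝔤) = u at hl ⊢
  induction hl using Submodule.span_induction with
  | mem u hu => obtain ⟨b, rfl⟩ := hu; exact hmul b
  | zero => simp [contract]
  | add p q _ _ hp hq =>
    rw [map_add, LinearMap.add_apply, contract_add, hp, hq, map_add, LinearMap.add_apply]
  | smul t p _ hp =>
    rw [map_smul, LinearMap.smul_apply, contract_smul, hp, map_smul, LinearMap.smul_apply]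

/-- A vector annihilated by `𝔫₊` on which the Cartan subalgebra acts by `lam`. -/
theorem lie_borel_eq_smul {N : Type*} [AddCommGroup N] [Module ℂ N] [LieRingModule 𝔤 N]
    [LieModule ℂ 𝔤 N] {n : N} (hh : ∀ h : 𝔥, ⁅(h : 𝔤), n⁆ = lam h • n)
    (he : ∀ j, ⁅D.e j, n⁆ = 0) (z : 𝔤) (hz : z ∈ borel Δ) : ⁅z, n⁆ = extend lam z • n := by
  obtain ⟨h, hh', y, hy, rfl⟩ := Submodule.mem_sup.1 hz
  have hy0 : ⁅y, n⁆ = 0 := by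
    clear hz
    rw [← D.span_e] at hy
    induction hy using Submodule.span_induction with
    | mem y hy => obtain ⟨j, rfl⟩ := hy; exact he j
    | zero => simp
    | add a b _ _ ha hb => rw [add_lie, ha, hb, add_zero]
    | smul t a _ ha => rw [smul_lie, ha, smul_zero]
  have h1 := hh ⟨h, hh'⟩
  have h2 := extend_cartan lam ⟨h, hh'⟩
  simp only at h1 h2
  rw [add_lie, hy0, add_zero, map_add, extend_nPos Δ lam hy, add_zero, h1, h2]

include D in
-- The forms u x_μ^* separate points of M_μ ⊗ V, so each required equation for w may be checked
-- after contraction, where it becomes an identity in V.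
theorem exists_singular_vector [Finite J] [FiniteDimensional ℂ V]
    (hxi : IsLowestWeightDual Δ mu xi)
    (hmu : LieModule.IsIrreducible ℂ 𝔤 (VermaModule Δ mu)) {v : V}
    (hv : ∀ h : 𝔥, ⁅(h : 𝔤), v⁆ = (lam - mu) h • v) :
    ∃ w : VermaModule Δ mu ⊗[ℂ] V, contract xi w = v ∧
      ∀ z ∈ borel Δ, ⁅z, w⁆ = extend lam z • w := by
  obtain ⟨w, hw⟩ := exists_contract_dualVector_eq D hxi hmu (hv D.level)
  have hsep : ∀ m, (∀ l, D.dualVector xi l m = 0) → m = 0 := fun m hm =>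
    eq_zero_of_dualVector_eq_zero D hxi hmu hm
  refine ⟨w, ?_, lie_borel_eq_smul D (fun h => ?_) (fun j => ?_)⟩
  · have := hw []
    rwa [RootVectors.dualVector, envAct_word_nil, envAct_word_nil] at this
  · rw [← sub_eq_zero]
    refine eq_zero_of_contract_eq_zero hsep fun l => ?_
    have h1 := lie_envAct_word D.e (fun j => D.lie_e h j) (hxi.lie_cartan h) l
    rw [← RootVectors.dualVector] at h1
    rw [map_sub, contract_lie, map_smul, h1, contract_smul, hw,
      lie_envAct_word D.e (fun j => D.lie_e h j) (hv h), ← sub_smul, ← sub_smul]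
    -- With s the weight of the word: u v has weight λ - μ + s and u x_μ^* has weight -μ + s; their
    -- difference is λ.
    rw [LinearMap.sub_apply, show ∀ a b s : ℂ, a - b + s - (-b + s) - a = 0 by intros; ring,
      zero_smul]
  · refine eq_zero_of_contract_eq_zero hsep fun l => ?_
    rw [contract_lie, D.lie_e_dualVector, hw, hw, envAct_word_cons, sub_self]

/-- As e_j w = 0, contracting with e_j p equals e_j applied to the contraction with p; the vanishing
spreads from x_μ^* to all words. -/
theorem singular_vector_eq_zero [FiniteDimensional ℂ V]
    (hxi : IsLowestWeightDual Δ mu xi)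
    (hmu : LieModule.IsIrreducible ℂ 𝔤 (VermaModule Δ mu)) {w : VermaModule Δ mu ⊗[ℂ] V}
    (he : ∀ j, ⁅D.e j, w⁆ = 0) (hw : contract xi w = 0) : w = 0 := by
  refine eq_zero_of_contract_eq_zero (p := D.dualVector xi)
    (fun m hm => eq_zero_of_dualVector_eq_zero D hxi hmu hm) fun l => ?_
  induction l with
  | nil => rwa [RootVectors.dualVector, envAct_word_nil]
  | cons j l ih =>
    have h := contract_lie (D.dualVector xi l) (D.e j) w
    rwa [he, map_zero, ih, lie_zero, zero_sub, zero_eq_neg, D.lie_e_dualVector] at h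

/-- Weights add under contraction: Φ(x_λ) contributes λ and x_μ^* contributes -μ. -/
theorem expectation_mem_weightSpace (hxi : IsLowestWeightDual Δ mu xi)
    (Phi : VermaModule Δ lam →ₗ⁅ℂ,𝔤⁆ VermaModule Δ mu ⊗[ℂ] V) :
    expectation Δ lam mu xi Phi ∈ LieModule.weightSpace (L := 𝔥) V (⇑(lam - mu)) := by
  refine (LieModule.mem_weightSpace _ _).2 fun h => ?_
  have h1 := contract_lie xi (h : 𝔤) (Phi (highestWeightVector Δ lam))
  rw [← LieModuleHom.map_lie, lie_cartan_highestWeightVector, map_smul, map_smul,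
    hxi.lie_cartan, contract_smul] at h1
  change ⁅(h : 𝔤), contract xi (Phi (highestWeightVector Δ lam))⁆ =
    (lam - mu) h • contract xi (Phi (highestWeightVector Δ lam))
  rw [LinearMap.sub_apply, sub_smul, h1, neg_smul]
  abel

/-- The expectation value as a linear map. -/
def expectationHom (lam : Module.Dual ℂ 𝔥) (hxi : IsLowestWeightDual Δ mu xi) :
    (VermaModule Δ lam →ₗ⁅ℂ,𝔤⁆ VermaModule Δ mu ⊗[ℂ] V) →ₗ[ℂ]
      LieModule.weightSpace (L := 𝔥) V (⇑(lam - mu)) where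
  toFun Phi := ⟨expectation Δ lam mu xi Phi, expectation_mem_weightSpace hxi Phi⟩
  map_add' Phi Psi := Subtype.ext (by simp [expectation])
  map_smul' c Phi := Subtype.ext (by simp [expectation])

include D in
theorem expectationHom_bijective [Finite J] [FiniteDimensional ℂ V]
    (hxi : IsLowestWeightDual Δ mu xi)
    (hmu : LieModule.IsIrreducible ℂ 𝔤 (VermaModule Δ mu)) :
    Function.Bijective (expectationHom (V := V) lam hxi) := by
  constructor
  · refine (injective_iff_map_eq_zero _).2 fun Phi hPhi => hom_ext ?_
    refine singular_vector_eq_zero D hxi hmu (fun j => ?_) (congrArg Subtype.val hPhi)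
    have hj : D.e j ∈ nPos Δ := D.span_e ▸ Submodule.subset_span ⟨j, rfl⟩
    rw [← LieModuleHom.map_lie, lie_highestWeightVector (nPos_le_borel Δ hj), extend_nPos Δ _ hj,
      zero_smul, map_zero]
  · rintro ⟨v, hv⟩
    obtain ⟨w, hw, hw'⟩ := exists_singular_vector (lam := lam) D hxi hmu
      ((LieModule.mem_weightSpace _ _).1 hv)
    obtain ⟨Phi, hPhi⟩ := exists_hom hw'
    exact ⟨Phi, Subtype.ext ((congrArg (contract xi) hPhi).trans hw)⟩

end Intertwiners

end Verma

end

theorem mainTheorem8 {𝔤 : Type*} [LieRing 𝔤] [LieAlgebra ℂ 𝔤] [FiniteDimensional ℂ 𝔤]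
    [LieAlgebra.IsSemisimple ℂ 𝔤] {𝔥 : LieSubalgebra ℂ 𝔤} [𝔥.IsCartanSubalgebra]
    (Δ : RootPairing.Base (LieAlgebra.IsKilling.rootSystem 𝔥))
    (lam mu : Module.Dual ℂ 𝔥)
    (hmu : LieModule.IsIrreducible ℂ 𝔤 (Verma.VermaModule Δ mu))
    {V : Type*} [AddCommGroup V] [Module ℂ V] [FiniteDimensional ℂ V]
    [LieRingModule 𝔤 V] [LieModule ℂ 𝔤 V] :
    (∃! xi : Module.Dual ℂ (Verma.VermaModule Δ mu), Verma.IsLowestWeightDual Δ mu xi) ∧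
    ∀ xi : Module.Dual ℂ (Verma.VermaModule Δ mu), Verma.IsLowestWeightDual Δ mu xi →
      ∃ e : (Verma.VermaModule Δ lam →ₗ⁅ℂ,𝔤⁆ Verma.VermaModule Δ mu ⊗[ℂ] V) ≃ₗ[ℂ]
          LieModule.weightSpace (L := 𝔥) V (⇑(lam - mu)),
        ∀ Phi, (e Phi : V) = Verma.expectation Δ lam mu xi Phi := by
  obtain ⟨D⟩ := Verma.exists_rootVectors Δ
  exact ⟨Verma.existsUnique_isLowestWeightDual D, fun xi hxi =>
    ⟨LinearEquiv.ofBijective (Verma.expectationHom lam hxi)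
      (Verma.expectationHom_bijective D hxi hmu), fun Phi => rfl⟩⟩
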